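/- Let $n\ge 2$ and let $\Omega\subset\mathbb{R}^n$ be a bounded open set with smooth boundary and $0\in\Omega$. Let $\omega_{n-1}$ be the surface measure of the unit sphere in $\mathbb{R}^n$, $\alpha_n=n\,\omega_{n-1}^{1/(n-1)}$, and let $\alpha>0$, $\beta\in[0,n)$ satisfy $\frac{\alpha}{\alpha_n}+\frac{\beta}{n}=1$. Put $$\mathcal{B}_1(\Omega)=\{v\in W_0^{1,n}(\Omega): \|\nabla v\|_{L^n(\Omega)}\le 1\},\qquad F_\Omega(v)=\int_\Omega\frac{e^{\alpha|v|^{n/(n-1)}}-1}{|x|^\beta}\,dx .$$ A sequence $\{v_i\}\subset W^{1,n}_0(\Omega)$ concentrates at $0$ if $\lim_{i\to\infty}\|\nabla v_i\|_{L^n(\Omega)}=1$ and $\lim_{i\to\infty}\int_{\Omega\setminus B_\epsilon(0)}|\nabla v_i|^n\,dx=0$ for every $\epsilon>0$. Let $$F_\Omega^\delta(0)=\sup\Big\{\limsup_{i\to\infty}F_\Omega(v_i)\ :\ \{v_i\}\subset\mathcal{B}_1(\Omega)\text{ concentrates at }0\Big\}.$$ Suppose that $\{u_i\}_{i\in\mathbb{N}}\subset\mathcal{B}_1(\Omega)\cap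 C^\infty(\Omega)$ is a sequence of nonnegative functions which concentrates at $0$ and satisfies $\lim_{i\to\infty}F_\Omega(u_i)=F_\Omega^\delta(0)$. Then for every $r>0$ there exist $j\in\mathbb{N}$ and $k_j\in[1,2]$ such that $$\{x\in\Omega: u_j(x)\ge k_j\}\cap B_r(0)\ne\emptyset$$ and every connected component $A$ of $\{x\in\Omega: u_j(x)\ge k_j\}$ has the following two properties: if $A\cap B_r(0)\neq\emptyset$, then $A\subset B_{2r}(0)$; and $A$ has smooth boundary. -/

import Mathlib

open Set Filter Topology MeasureTheory
open scoped ENNReal ContDiff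

namespace MoserTrudinger

/-- `φ ∈ C_c^∞(Ω)`. -/
def IsTestFunction {n : ℕ} (Ω : Set (EuclideanSpace ℝ (Fin n)))
    (φ : EuclideanSpace ℝ (Fin n) → ℝ) : Prop :=
  ContDiff ℝ ∞ φ ∧ HasCompactSupport φ ∧ tsupport φ ⊆ Ω

/-- `G` is the weak (distributional) gradient of `v` on the open set `Ω`. -/
def HasWeakGradient {n : ℕ} (Ω : Set (EuclideanSpace ℝ (Fin n)))
    (v : EuclideanSpace ℝ (Fin n) → ℝ)
    (G : EuclideanSpace ℝ (Fin n) → EuclideanSpace ℝ (Fin n)) : Prop :=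
  LocallyIntegrableOn v Ω volume ∧ LocallyIntegrableOn G Ω volume ∧
    ∀ φ : EuclideanSpace ℝ (Fin n) → ℝ, IsTestFunction Ω φ →
      ∫ x in Ω, v x • gradient φ x = -∫ x in Ω, φ x • G x

open Classical in
/-- The weak gradient of `v` on `Ω` (unique almost everywhere on `Ω` when it exists; the value is
`0` when there is none). -/
noncomputable def weakGrad {n : ℕ} (Ω : Set (EuclideanSpace ℝ (Fin n)))
    (v : EuclideanSpace ℝ (Fin n) → ℝ) : EuclideanSpace ℝ (Fin n) → EuclideanSpace ℝ (Fin n) :=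
  if h : ∃ G, HasWeakGradient Ω v G then h.choose else 0

/-- `v ∈ W^{1,n}(Ω)`, where `n` is the dimension. Only the values of `v` on `Ω` matter. -/
def MemW1n {n : ℕ} (Ω : Set (EuclideanSpace ℝ (Fin n)))
    (v : EuclideanSpace ℝ (Fin n) → ℝ) : Prop :=
  (∃ G, HasWeakGradient Ω v G) ∧ MemLp v (n : ℝ≥0∞) (volume.restrict Ω) ∧
    MemLp (weakGrad Ω v) (n : ℝ≥0∞) (volume.restrict Ω)

/-- `v ∈ W_0^{1,n}(Ω)`: the closure of `C_c^∞(Ω)` in `W^{1,n}(Ω)`. -/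
def MemW1n0 {n : ℕ} (Ω : Set (EuclideanSpace ℝ (Fin n)))
    (v : EuclideanSpace ℝ (Fin n) → ℝ) : Prop :=
  MemW1n Ω v ∧ ∀ ε : ℝ≥0∞, 0 < ε → ∃ φ : EuclideanSpace ℝ (Fin n) → ℝ, IsTestFunction Ω φ ∧
    eLpNorm (fun x => v x - φ x) (n : ℝ≥0∞) (volume.restrict Ω) < ε ∧
    eLpNorm (fun x => weakGrad Ω v x - gradient φ x) (n : ℝ≥0∞) (volume.restrict Ω) < ε

/-- `‖∇v‖_{L^n(Ω)}`. -/
noncomputable def gradNorm {n : ℕ} (Ω : Set (EuclideanSpace ℝ (Fin n)))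
    (v : EuclideanSpace ℝ (Fin n) → ℝ) : ℝ≥0∞ :=
  eLpNorm (weakGrad Ω v) (n : ℝ≥0∞) (volume.restrict Ω)

/-- The set `{v ∈ W_0^{1,n}(Ω) : ‖∇v‖_{L^n} ≤ 1}`. -/
def unitBall {n : ℕ} (Ω : Set (EuclideanSpace ℝ (Fin n))) :
    Set (EuclideanSpace ℝ (Fin n) → ℝ) :=
  {v | MemW1n0 Ω v ∧ gradNorm Ω v ≤ 1}

/-- The sequence `u` in `W_0^{1,n}(Ω)` concentrates at `x₀`. -/
def ConcentratesAt {n : ℕ} (Ω : Set (EuclideanSpace ℝ (Fin n)))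
    (u : ℕ → EuclideanSpace ℝ (Fin n) → ℝ) (x₀ : EuclideanSpace ℝ (Fin n)) : Prop :=
  Tendsto (fun i => gradNorm Ω (u i)) atTop (𝓝 1) ∧
    ∀ ε : ℝ, 0 < ε →
      Tendsto (fun i => ∫⁻ x in Ω \ Metric.ball x₀ ε, ‖weakGrad Ω (u i) x‖ₑ ^ n) atTop (𝓝 0)

/-- `ω_{n-1}`, the surface measure of the unit sphere of `ℝⁿ`. -/
noncomputable def sphereArea (n : ℕ) : ℝ :=
  ((volume : Measure (EuclideanSpace ℝ (Fin n))).toSphere).real Set.univ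

/-- `α_n = n ω_{n-1}^{1/(n-1)}`. -/
noncomputable def alphaCrit (n : ℕ) : ℝ :=
  (n : ℝ) * sphereArea n ^ (1 / ((n : ℝ) - 1))

/-- `F_Ω(v) = ∫_Ω (exp(α |v|^{n/(n-1)}) - 1) / |x|^β dx`; the integrand is nonnegative, and the
integral is taken with values in `[0, ∞]`. -/
noncomputable def F {n : ℕ} (α β : ℝ) (Ω : Set (EuclideanSpace ℝ (Fin n)))
    (v : EuclideanSpace ℝ (Fin n) → ℝ) : ℝ≥0∞ :=
  ∫⁻ x in Ω, ENNReal.ofReal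
    ((Real.exp (α * |v x| ^ ((n : ℝ) / ((n : ℝ) - 1))) - 1) / ‖x‖ ^ β)

/-- `F_Ω^δ(x₀)`: the supremum of `limsup F_Ω(u_i)` over the sequences of `unitBall Ω` that
concentrate at `x₀`. -/
noncomputable def Fdelta {n : ℕ} (α β : ℝ) (Ω : Set (EuclideanSpace ℝ (Fin n)))
    (x₀ : EuclideanSpace ℝ (Fin n)) : ℝ≥0∞ :=
  sSup {s | ∃ u : ℕ → EuclideanSpace ℝ (Fin n) → ℝ,
    (∀ i, u i ∈ unitBall Ω) ∧ ConcentratesAt Ω u x₀ ∧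
      s = limsup (fun i => F α β Ω (u i)) atTop}

/-- The set `A` has smooth boundary: near each of its boundary points, `∂A` is the zero set of a
smooth function `ψ` with nonvanishing differential at the point, and the interior of `A` is
`{ψ < 0}`. So locally an open such `A` is `{ψ < 0}`, and a closed one is `{ψ ≤ 0}`. -/
def HasSmoothBoundary {n : ℕ} (A : Set (EuclideanSpace ℝ (Fin n))) : Prop :=
  ∀ p ∈ frontier A, ∃ (U : Set (EuclideanSpace ℝ (Fin n))) (ψ : EuclideanSpace ℝ (Fin n) → ℝ),
    IsOpen U ∧ p ∈ U ∧ ContDiffOn ℝ ∞ ψ U ∧ fderiv ℝ ψ p ≠ 0 ∧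
      frontier A ∩ U = {x ∈ U | ψ x = 0} ∧ interior A ∩ U = {x ∈ U | ψ x < 0}

end MoserTrudinger

/-! The level `k` is a regular value of `u j` in [1, 2], given by Sard's theorem. The rest is a
capacity argument: where v ≥ 1 on a connected set, the set carries n-energy at least proportional to
its extent, unless v is already large on average nearby.

Averages are taken over the rings R/2 < |y - x| < R (`ringMean`). Telescoping them over dyadic radii
shows that v(x) < 1 if the average at scale R is small and the energy of B(x, R/2^k) is at most
θ/2^k for all k, with θ small (`abs_mul_le_of_energy_decay`). So a point with v ≥ 1 and small
average is the centre of a ball whose energy exceeds a fixed multiple of radius/R. A Vitali covering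
by such balls, projected by the distance to p, gives `exists_crossing_const`: a set meeting every
sphere about p with radius in (a, a + l) satisfies l ≤ c R · energy.

This is used twice. Crossing r < |x| < 2r is impossible once the energy off B_{r/2}(0) is small,
which concentration provides (`exists_energy_bound_subset_ball`). A component cannot accumulate at p
∈ ∂Ω either: the zero extension vanishes on a cone at p, so averages near p are small, and the
energy of B_{3ρ}(p) tends to 0 (`closure_subset_of_isPreconnected`). Components are therefore closed
and stay inside Ω, and a regular level gives them a smooth boundary.

It remains to find points of B_r(0) where `u j` > 2, for arbitrarily large `j`. If there were none,
F(u_j) would tend to 0 (`tendsto_F_zero_of_bounded`): near 0 the functions are bounded and |x|^{-β}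
is integrable, and away from 0 the dyadic estimate makes the level sets decay exponentially, with
constants governed by the vanishing energy. But Moser's truncated logarithms keep F bounded below at
the critical exponent, so the limit `Fdelta` is positive (`Fdelta_pos`). -/

namespace MoserTrudinger

/-! ### Sard's theorem for smooth real-valued functions -/

section Sard

variable {E F : Type} [NormedAddCommGroup E] [NormedSpace ℝ E]
  [NormedAddCommGroup F] [NormedSpace ℝ F]

/-- First order Taylor estimate at a point where the derivatives of order `1, …, k` vanish. -/
theorem norm_sub_le_of_iteratedFDeriv_eq_zero (k : ℕ) : ∀ {F : Type} [NormedAddCommGroup F]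
    [NormedSpace ℝ F] {f : E → F} {V : Set E} {M : ℝ}, Convex ℝ V →
    (∀ x ∈ V, ContDiffAt ℝ ∞ f x) → (∀ x ∈ V, ‖iteratedFDeriv ℝ (k + 1) f x‖ ≤ M) →
    ∀ x ∈ V, (∀ i, 1 ≤ i → i ≤ k → iteratedFDeriv ℝ i f x = 0) → ∀ y ∈ V,
      ‖f y - f x‖ ≤ M * ‖y - x‖ ^ (k + 1) := by
  induction k with
  | zero =>
    intro F _ _ f V M hV hf hM x hx _ y hy
    rw [zero_add, pow_one]
    refine hV.norm_image_sub_le_of_norm_fderiv_le (𝕜 := ℝ)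
      (fun z hz => (hf z hz).differentiableAt (by simp)) (fun z hz => ?_) hx hy
    rw [← norm_iteratedFDeriv_one]
    exact hM z hz
  | succ k ih =>
    intro F _ _ f V M hV hf hM x hx h0 y hy
    have hM0 : 0 ≤ M := (norm_nonneg _).trans (hM x hx)
    have hg : ∀ z ∈ V, ‖fderiv ℝ f z - fderiv ℝ f x‖ ≤ M * ‖z - x‖ ^ (k + 1) := by
      refine ih (f := fderiv ℝ f) hV (fun z hz => (hf z hz).fderiv_right (by simp)) (fun z hz => ?_) x hx
        (fun i _ hik => ?_)
      · rw [norm_iteratedFDeriv_fderiv]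
        exact hM z hz
      · rw [← norm_eq_zero, norm_iteratedFDeriv_fderiv, h0 (i + 1) (by omega) (by omega), norm_zero]
    have hx0 : fderiv ℝ f x = 0 := by
      rw [← norm_eq_zero, ← norm_iteratedFDeriv_one, h0 1 le_rfl (by omega), norm_zero]
    -- On this smaller convex set ‖z - x‖ ≤ ‖y - x‖, so the bound on the derivative is uniform and
    -- the mean value inequality gains one power.
    have hc : Convex ℝ (V ∩ Metric.closedBall x ‖y - x‖) := hV.inter (convex_closedBall _ _)
    have := hc.norm_image_sub_le_of_norm_fderiv_le (𝕜 := ℝ) (f := f) (C := M * ‖y - x‖ ^ (k + 1))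
      (fun z hz => (hf z hz.1).differentiableAt (by simp)) (fun z hz => ?_)
      ⟨hx, by simp⟩ ⟨hy, by simp [dist_eq_norm]⟩
    · calc _ ≤ _ := this
        _ = _ := by ring
    · have h1 := hg z hz.1
      rw [hx0, sub_zero] at h1
      refine h1.trans ?_
      have h2 : ‖z - x‖ ≤ ‖y - x‖ := by simpa [dist_eq_norm] using hz.2
      gcongr

variable [FiniteDimensional ℝ E]

/-- Inverse function theorem for the map (g, P), with P a projection onto the kernel of the
differential at `x₀`: `g` becomes the first coordinate, so its level sets become hyperplanes and its
superlevel sets half-spaces. -/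
theorem exists_straightening {g : E → ℝ} {x₀ : E} {W : Set E} (hW : IsOpen W) (hx₀ : x₀ ∈ W)
    (hg : ∀ x ∈ W, ContDiffAt ℝ ∞ g x) (h0 : fderiv ℝ g x₀ ≠ 0) :
    ∃ Ψ : OpenPartialHomeomorph E (ℝ × (fderiv ℝ g x₀).ker), x₀ ∈ Ψ.source ∧ Ψ.source ⊆ W ∧
      (∀ x ∈ Ψ.source, (Ψ x).1 = g x) ∧ ∀ z ∈ Ψ.target, ContDiffAt ℝ ∞ Ψ.symm z := by
  set L := fderiv ℝ g x₀ with hL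
  have hsurj : Function.Surjective L := by
    refine LinearMap.surjective (f := (L : E →ₗ[ℝ] ℝ)) ?_
    exact fun h => h0 (ContinuousLinearMap.coe_injective h)
  obtain ⟨P, hP⟩ := L.ker_closedComplemented_of_finiteDimensional_range
  have hPs : P.range = ⊤ := by
    rw [LinearMap.range_eq_top]
    exact fun z => ⟨z, hP z⟩
  let e : E ≃L[ℝ] ℝ × L.ker := ContinuousLinearMap.equivProdOfSurjectiveOfIsCompl L P
    (LinearMap.range_eq_top.2 hsurj) hPs (LinearMap.isCompl_of_proj hP)
  have he : ∀ x, (e x).1 = L x := fun x => rfl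
  -- This is (g, P), written as the linear equivalence `e` = (L, P) plus a term whose derivative
  -- vanishes at `x₀`.
  let Φ : E → ℝ × L.ker := fun x => e x + (g x - L x, 0)
  have hΦ : ∀ x ∈ W, ContDiffAt ℝ ∞ Φ x := fun x hx =>
    e.contDiff.contDiffAt.add (((hg x hx).sub L.contDiff.contDiffAt).prodMk contDiffAt_const)
  have hd : HasFDerivAt Φ (e : E →L[ℝ] ℝ × L.ker) x₀ := by
    have h1 : HasFDerivAt g L x₀ := ((hg x₀ hx₀).differentiableAt (by simp)).hasFDerivAt
    have h2 := (e.hasFDerivAt (x := x₀)).add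
      ((h1.sub L.hasFDerivAt).prodMk (hasFDerivAt_const (0 : L.ker) x₀))
    have h3 : (e : E →L[ℝ] ℝ × L.ker) + (L - L).prod (0 : E →L[ℝ] L.ker) = e := by
      rw [sub_self]
      ext x <;> simp
    rw [h3] at h2
    exact h2
  let Ψ₀ := (hΦ x₀ hx₀).toOpenPartialHomeomorph Φ hd (by simp)
  have hcont : ContinuousAt (fderiv ℝ Φ) x₀ :=
    ((hΦ x₀ hx₀).fderiv_right (m := 0) (by simp)).continuousAt
  -- The inverse has to be smooth on the whole target, so the source is cut down to points where the
  -- derivative is invertible.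
  have hmem : {x | fderiv ℝ Φ x ∈ range ((↑) : (E ≃L[ℝ] ℝ × L.ker) → E →L[ℝ] ℝ × L.ker)} ∈ 𝓝 x₀ :=
    hcont (by rw [hd.fderiv]; exact ContinuousLinearEquiv.nhds e)
  obtain ⟨V, hVs, hVo, hxV⟩ := mem_nhds_iff.1 (inter_mem hmem (hW.mem_nhds hx₀))
  refine ⟨Ψ₀.restrOpen V hVo, ?_, ?_, ?_, ?_⟩
  · exact ⟨(hΦ x₀ hx₀).mem_toOpenPartialHomeomorph_source hd (by simp), hxV⟩
  · exact fun x hx => (hVs hx.2).2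
  · intro x hx
    change (Φ x).1 = g x
    simp [Φ, he]
  · intro z hz
    have hzs := (Ψ₀.restrOpen V hVo).map_target hz
    obtain ⟨e', he'⟩ := (hVs hzs.2).1
    refine OpenPartialHomeomorph.contDiffAt_symm (f₀' := e') _ hz ?_ (hΦ _ (hVs hzs.2).2)
    rw [he']
    exact ((hΦ _ (hVs hzs.2).2).differentiableAt (by simp)).hasFDerivAt

/-- **Sard's theorem** for smooth real functions, on spaces of dimension `d`. -/
theorem volume_image_critical_eq_zero_aux (d : ℕ) : ∀ (E : Type) [NormedAddCommGroup E]
    [NormedSpace ℝ E] [FiniteDimensional ℝ E], Module.finrank ℝ E = d → ∀ (f : E → ℝ) (U : Set E),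
    IsOpen U → (∀ x ∈ U, ContDiffAt ℝ ∞ f x) →
    volume (f '' {x ∈ U | fderiv ℝ f x = 0}) = 0 := by
  induction d with
  | zero =>
    intro E _ _ _ hE f U _ _
    have : Subsingleton E := Module.finrank_zero_iff.1 hE
    exact ((Set.subsingleton_of_subsingleton (s := {x ∈ U | fderiv ℝ f x = 0})).image f).measure_zero _
  | succ d ih =>
    intro E _ _ _ hE f U hU hf
    -- Pulling Lebesgue measure back along `f` turns nullity of the image into a property of subsets
    -- of `E` that can be checked locally.
    let m : OuterMeasure E := OuterMeasure.comap f (volume : Measure ℝ).toOuterMeasure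
    have hm : ∀ s, m s = volume (f '' s) := fun s => rfl
    -- On `A`, Taylor's estimate makes `f` locally Hölder of exponent d + 2, above the dimension d +
    -- 1, so the image is null. Near a point of `B k`, some k-th partial derivative is a defining
    -- function of a hypersurface containing `B k`; the restriction of `f` to it is still critical
    -- there, and the induction hypothesis applies in dimension d. (`B 0` is empty.)
    let A : Set E := {x ∈ U | ∀ i, 1 ≤ i → i ≤ d + 1 → iteratedFDeriv ℝ i f x = 0}
    let B : ℕ → Set E := fun k => {x ∈ U | fderiv ℝ f x = 0 ∧ iteratedFDeriv ℝ k f x = 0 ∧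
      iteratedFDeriv ℝ (k + 1) f x ≠ 0}
    have hik : ∀ k : ℕ, ∀ y ∈ U, ContDiffAt ℝ ∞ (iteratedFDeriv ℝ k f) y := fun k y hy =>
      (hf y hy).iteratedFDeriv_right (by exact_mod_cast le_top)
    have hA : m A = 0 := by
      refine measure_null_of_locally_null _ fun x hx => ?_
      have hc : ContinuousAt (fun y => ‖iteratedFDeriv ℝ (d + 2) f y‖) x :=
        (hik (d + 2) x hx.1).continuousAt.norm
      have h1 : ∀ᶠ y in 𝓝 x, ‖iteratedFDeriv ℝ (d + 2) f y‖ < ‖iteratedFDeriv ℝ (d + 2) f x‖ + 1 :=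
        hc.eventually_lt continuousAt_const (by simp)
      obtain ⟨ε, hε, hball⟩ := Metric.mem_nhds_iff.1 (inter_mem h1 (hU.mem_nhds hx.1))
      refine ⟨A ∩ Metric.ball x ε, inter_mem_nhdsWithin _ (Metric.ball_mem_nhds x hε), ?_⟩
      rw [hm]
      set M : ℝ := ‖iteratedFDeriv ℝ (d + 2) f x‖ + 1
      have hM : 0 ≤ M := by positivity
      have hH : HolderOnWith M.toNNReal ((d + 2 : ℕ) : NNReal) f (A ∩ Metric.ball x ε) := by
        intro y hy z hz
        have := norm_sub_le_of_iteratedFDeriv_eq_zero (d + 1) (f := f) (M := M)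
          (convex_ball x ε) (fun w hw => hf w (hball hw).2) (fun w hw => le_of_lt (hball hw).1)
          z hz.2 hz.1.2 y hy.2
        rw [edist_eq_enorm_sub, edist_eq_enorm_sub, ← ofReal_norm, ← ofReal_norm,
          NNReal.coe_natCast, ENNReal.rpow_natCast, ← ENNReal.ofReal_pow (norm_nonneg _)]
        change _ ≤ ENNReal.ofReal M * _
        rw [← ENNReal.ofReal_mul hM]
        exact ENNReal.ofReal_le_ofReal this
      let _ : MeasurableSpace E := borel E
      have _ : BorelSpace E := ⟨rfl⟩
      have h2 := hH.hausdorffMeasure_image_le (by positivity) (d := 1) zero_le_one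
      rw [hausdorffMeasure_real] at h2
      refine le_antisymm (h2.trans ?_) zero_le
      have h3 : μH[((d + 2 : ℕ) : NNReal) * 1] (A ∩ Metric.ball x ε) = 0 := by
        rw [mul_one]
        refine measure_mono_null (subset_univ _) ?_
        have := hausdorffMeasure_of_dimH_lt (X := E) (s := univ) (d := ((d + 2 : ℕ) : NNReal)) ?_
        · exact this
        · rw [Real.dimH_univ_eq_finrank, hE]
          norm_cast
          omega
      rw [h3, mul_zero]
    have hB : ∀ k, m (B k) = 0 := by
      intro k
      refine measure_null_of_locally_null _ fun x hx => ?_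
      obtain ⟨hxU, hx1, hxk, hxk1⟩ := hx
      have hne : fderiv ℝ (iteratedFDeriv ℝ k f) x ≠ 0 := by
        intro h
        apply hxk1
        ext w
        rw [iteratedFDeriv_succ_apply_left, h]
        simp
      obtain ⟨w, hw⟩ : ∃ w, fderiv ℝ (iteratedFDeriv ℝ k f) x w ≠ 0 := by
        by_contra! h
        exact hne (ContinuousLinearMap.ext h)
      obtain ⟨w', hw'⟩ : ∃ w', fderiv ℝ (iteratedFDeriv ℝ k f) x w w' ≠ 0 := by
        by_contra! h
        exact hw (ContinuousMultilinearMap.ext h)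
      let g : E → ℝ := fun y => iteratedFDeriv ℝ k f y w'
      let ev := ContinuousMultilinearMap.apply ℝ (fun _ : Fin k => E) ℝ w'
      have hgs : ∀ y ∈ U, ContDiffAt ℝ ∞ g y := fun y hy =>
        (ev.contDiff.contDiffAt).comp y (hik k y hy)
      have hg0 : fderiv ℝ g x ≠ 0 := by
        intro h
        apply hw'
        have h1 : HasFDerivAt g (ev.comp (fderiv ℝ (iteratedFDeriv ℝ k f) x)) x :=
          ev.hasFDerivAt.comp x ((hik k x hxU).differentiableAt (by simp)).hasFDerivAt
        rw [h1.fderiv] at h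
        exact congrArg (fun T : E →L[ℝ] ℝ => T w) h
      obtain ⟨Ψ, hxΨ, hΨU, hΨ1, hΨs⟩ := exists_straightening hU hxU hgs hg0
      refine ⟨B k ∩ Ψ.source, inter_mem_nhdsWithin _ (Ψ.open_source.mem_nhds hxΨ), ?_⟩
      have hker : Module.finrank ℝ (fderiv ℝ g x).ker = d := by
        have h1 := LinearMap.finrank_range_add_finrank_ker (fderiv ℝ g x : E →ₗ[ℝ] ℝ)
        have h2 : LinearMap.range (fderiv ℝ g x : E →ₗ[ℝ] ℝ) = ⊤ := by
          rw [LinearMap.range_eq_top]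
          exact LinearMap.surjective (fun h => hg0 (ContinuousLinearMap.coe_injective h))
        rw [h2, finrank_top, Module.finrank_self, hE] at h1
        change Module.finrank ℝ (LinearMap.ker (fderiv ℝ g x : E →ₗ[ℝ] ℝ)) = d
        omega
      let ι : (fderiv ℝ g x).ker → ℝ × (fderiv ℝ g x).ker := fun z => (0, z)
      have hι : ContDiff ℝ ∞ ι := contDiff_const.prodMk contDiff_id
      have hmain := ih _ hker (f ∘ Ψ.symm ∘ ι) (ι ⁻¹' Ψ.target)
        (Ψ.open_target.preimage hι.continuous) (fun z hz =>
          (hf _ (hΨU (Ψ.map_target hz))).comp z ((hΨs _ hz).comp z hι.contDiffAt))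
      rw [hm]
      refine measure_mono_null ?_ hmain
      rintro _ ⟨y, ⟨hyB, hyΨ⟩, rfl⟩
      have hy0 : ι (Ψ y).2 = Ψ y := by
        refine Prod.ext ?_ rfl
        change 0 = (Ψ y).1
        rw [hΨ1 y hyΨ]
        simp [g, hyB.2.2.1]
      have hyt : ι (Ψ y).2 ∈ Ψ.target := by rw [hy0]; exact Ψ.map_source hyΨ
      have hys : Ψ.symm (ι (Ψ y).2) = y := by rw [hy0]; exact Ψ.left_inv hyΨ
      refine ⟨(Ψ y).2, ⟨hyt, ?_⟩, by simp only [Function.comp]; rw [hys]⟩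
      have hdf : HasFDerivAt f (0 : E →L[ℝ] ℝ) (Ψ.symm (ι (Ψ y).2)) := by
        rw [hys, ← hyB.2.1]
        exact ((hf y hyB.1).differentiableAt (by simp)).hasFDerivAt
      have hds : DifferentiableAt ℝ (Ψ.symm ∘ ι) (Ψ y).2 :=
        ((hΨs _ hyt).comp _ hι.contDiffAt).differentiableAt (by simp)
      have := HasFDerivAt.comp (Ψ y).2 hdf hds.hasFDerivAt
      rw [this.fderiv]
      simp
    have hsub : {x ∈ U | fderiv ℝ f x = 0} ⊆ A ∪ ⋃ k, B k := by
      intro x hx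
      by_cases h : ∃ i, 1 ≤ i ∧ iteratedFDeriv ℝ i f x ≠ 0
      · right
        classical
        have hs := Nat.find_spec h
        have hmin := fun i hi => Nat.find_min h (m := i) hi
        set i := Nat.find h
        have hi2 : i ≠ 1 := by
          intro hi
          apply hs.2
          rw [hi, ← norm_eq_zero, norm_iteratedFDeriv_one, hx.2, norm_zero]
        refine mem_iUnion.2 ⟨i - 1, hx.1, hx.2, ?_, ?_⟩
        · by_contra hcon
          exact hmin (i - 1) (by omega) ⟨by omega, hcon⟩
        · rw [Nat.sub_add_cancel hs.1]
          exact hs.2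
      · push Not at h
        exact Or.inl ⟨hx.1, fun i hi _ => h i hi⟩
    change m _ = 0
    exact measure_mono_null hsub (measure_union_null hA (measure_iUnion_null hB))

theorem volume_image_critical_eq_zero {f : E → ℝ} {U : Set E} (hU : IsOpen U)
    (hf : ContDiffOn ℝ ∞ f U) : volume (f '' {x ∈ U | fderiv ℝ f x = 0}) = 0 :=
  volume_image_critical_eq_zero_aux _ E rfl f U hU fun _ hx => hf.contDiffAt (hU.mem_nhds hx)

end Sard

/-! ### Smooth boundary of superlevel components at a regular level -/

section SuperlevelComponent

theorem subset_connectedComponentIn_of_inter_nonempty {X : Type*} [TopologicalSpace X]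
    {S V : Set X} {x : X} (hV : IsPreconnected V) (hVS : V ⊆ S)
    (h : (V ∩ connectedComponentIn S x).Nonempty) : V ⊆ connectedComponentIn S x := by
  obtain ⟨y, hyV, hyA⟩ := h
  rw [connectedComponentIn_eq hyA]
  exact hV.subset_connectedComponentIn hyV hVS

theorem le_of_mem_closure_superlevel {X : Type*} [TopologicalSpace X] {Ω A : Set X} {u : X → ℝ}
    {k : ℝ} (hΩ : IsOpen Ω) (hu : ContinuousOn u Ω) (hA : ∀ x ∈ A, k ≤ u x) {p : X}
    (hp : p ∈ closure A) (hpΩ : p ∈ Ω) : k ≤ u p := by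
  by_contra! h
  have h1 := (hu.continuousAt (hΩ.mem_nhds hpΩ)).eventually_lt continuousAt_const h
  obtain ⟨y, hy1, hy2⟩ := mem_closure_iff_nhds.1 hp _ h1
  exact absurd (hA y hy2) (not_le.2 hy1)

/-- The closure of the component is connected and inside the superlevel set, so the component is
closed; a boundary point is then at level `k`, since a small ball around a point with u > k would
join the component. In a straightening chart the component fills the whole half-ball u ≥ k, so no
other part of the superlevel set interferes and k - u is a defining function. -/
theorem hasSmoothBoundary_connectedComponentIn {n : ℕ} {Ω : Set (EuclideanSpace ℝ (Fin n))}
    {u : EuclideanSpace ℝ (Fin n) → ℝ} {k : ℝ} (hΩ : IsOpen Ω) (hu : ContDiffOn ℝ ∞ u Ω)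
    (hreg : ∀ x ∈ Ω, u x = k → fderiv ℝ u x ≠ 0) {x : EuclideanSpace ℝ (Fin n)}
    (hcl : closure (connectedComponentIn {x ∈ Ω | k ≤ u x} x) ⊆ Ω) :
    HasSmoothBoundary (connectedComponentIn {x ∈ Ω | k ≤ u x} x) := by
  set S := {x ∈ Ω | k ≤ u x} with hS
  set A := connectedComponentIn S x with hA
  have hAS : A ⊆ S := connectedComponentIn_subset _ _
  have huc : ContinuousOn u Ω := hu.continuousOn
  have huat : ∀ y ∈ Ω, ContDiffAt ℝ ∞ u y := fun y hy => hu.contDiffAt (hΩ.mem_nhds hy)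
  have hclS : closure A ⊆ S := fun y hy =>
    ⟨hcl hy, le_of_mem_closure_superlevel hΩ huc (fun z hz => (hAS hz).2) hy (hcl hy)⟩
  have hclA : closure A ⊆ A := by
    intro y hy
    have hne : A.Nonempty := closure_nonempty_iff.1 ⟨y, hy⟩
    obtain ⟨z, hz⟩ := hne
    exact subset_connectedComponentIn_of_inter_nonempty
      isPreconnected_connectedComponentIn.closure hclS ⟨z, subset_closure hz, hz⟩ hy
  intro p hp
  have hpA : p ∈ A := hclA hp.1
  have hpΩ : p ∈ Ω := (hAS hpA).1
  have hpk : u p = k := by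
    refine le_antisymm ?_ (hAS hpA).2
    by_contra! h
    apply hp.2
    have h1 : ∀ᶠ y in 𝓝 p, k < u y :=
      continuousAt_const.eventually_lt (huc.continuousAt (hΩ.mem_nhds hpΩ)) h
    obtain ⟨ε, hε, hball⟩ := Metric.mem_nhds_iff.1 (inter_mem h1 (hΩ.mem_nhds hpΩ))
    refine mem_interior.2 ⟨Metric.ball p ε, ?_, Metric.isOpen_ball, Metric.mem_ball_self hε⟩
    exact subset_connectedComponentIn_of_inter_nonempty (convex_ball p ε).isPreconnected
      (fun y hy => ⟨(hball hy).2, le_of_lt (hball hy).1⟩) ⟨p, Metric.mem_ball_self hε, hpA⟩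
  obtain ⟨Ψ, hpΨ, hΨΩ, hΨ1, hΨs⟩ := exists_straightening hΩ hpΩ huat (hreg p hpΩ hpk)
  obtain ⟨ε, hε, hball⟩ := Metric.isOpen_iff.1 Ψ.open_target _ (Ψ.map_source hpΨ)
  set U := Ψ.source ∩ Ψ ⁻¹' Metric.ball (Ψ p) ε with hU
  have hUo : IsOpen U := Ψ.isOpen_inter_preimage Metric.isOpen_ball
  have hpU : p ∈ U := ⟨hpΨ, Metric.mem_ball_self hε⟩
  have hUΩ : U ⊆ Ω := fun y hy => hΨΩ hy.1
  -- In the chart the superlevel set is a convex half-ball containing the image of `p`; its preimage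
  -- is connected and so belongs to the component of `p`.
  have hSU : ∀ y ∈ U, k ≤ u y → y ∈ A := by
    have himg : Ψ.symm '' (Metric.ball (Ψ p) ε ∩ {z | k ≤ z.1}) ⊆ A := by
      refine subset_connectedComponentIn_of_inter_nonempty ?_ ?_ ⟨p, ?_, hpA⟩
      · refine IsPreconnected.image (Convex.isPreconnected ?_) _
          (Ψ.continuousOn_symm.mono (inter_subset_left.trans hball))
        refine (convex_ball _ _).inter ?_
        exact convex_halfSpace_ge (f := Prod.fst) (LinearMap.fst ℝ ℝ _).isLinear k
      · rintro _ ⟨z, ⟨hz1, hz2⟩, rfl⟩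
        have hs := Ψ.map_target (hball hz1)
        refine ⟨hΨΩ hs, ?_⟩
        rw [← hΨ1 _ hs, Ψ.right_inv (hball hz1)]
        exact hz2
      · refine ⟨Ψ p, ⟨Metric.mem_ball_self hε, ?_⟩, Ψ.left_inv hpΨ⟩
        change k ≤ (Ψ p).1
        rw [hΨ1 p hpΨ, hpk]
    intro y hy hky
    refine himg ⟨Ψ y, ⟨hy.2, ?_⟩, Ψ.left_inv hy.1⟩
    change k ≤ (Ψ y).1
    rwa [hΨ1 y hy.1]
  have hint : ∀ y ∈ U, (y ∈ interior A ↔ k < u y) := by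
    intro y hy
    constructor
    · intro hyi
      -- An interior point of `A` at level `k` would be a local minimum of `u`, hence critical.
      refine lt_of_le_of_ne (hAS (interior_subset hyi)).2 fun hk => ?_
      refine hreg y (hUΩ hy) hk.symm (IsLocalMin.fderiv_eq_zero ?_)
      filter_upwards [mem_interior_iff_mem_nhds.1 hyi] with z hz
      rw [← hk]
      exact (hAS hz).2
    · intro hk
      have h1 : ∀ᶠ z in 𝓝 y, k < u z :=
        continuousAt_const.eventually_lt (huc.continuousAt (hΩ.mem_nhds (hUΩ hy))) hk
      refine mem_interior_iff_mem_nhds.2 ?_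
      filter_upwards [h1, hUo.mem_nhds hy] with z hz hzU
      exact hSU z hzU hz.le
  refine ⟨U, fun y => k - u y, hUo, hpU, contDiffOn_const.sub (hu.mono hUΩ), ?_, ?_, ?_⟩
  · rw [fderiv_const_sub]
    exact neg_ne_zero.2 (hreg p hpΩ hpk)
  · ext y
    simp only [mem_inter_iff, mem_ofPred_eq]
    constructor
    · rintro ⟨hyf, hyU⟩
      refine ⟨hyU, ?_⟩
      have h1 : ¬ k < u y := fun h => hyf.2 ((hint y hyU).2 h)
      have h2 := (hclS hyf.1).2
      linarith
    · rintro ⟨hyU, hy⟩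
      refine ⟨⟨subset_closure (hSU y hyU (by linarith)), fun h => ?_⟩, hyU⟩
      have := (hint y hyU).1 h
      linarith
  · ext y
    simp only [mem_inter_iff, mem_ofPred_eq]
    constructor
    · rintro ⟨hyf, hyU⟩
      have := (hint y hyU).1 hyf
      exact ⟨hyU, by linarith⟩
    · rintro ⟨hyU, hy⟩
      exact ⟨(hint y hyU).2 (by linarith), hyU⟩

end SuperlevelComponent

/-! ### Ring averages and their variation in terms of the n-energy -/

section RingMean

/-- The Euclidean space of dimension `n`. -/
abbrev Eucl (n : ℕ) : Type := EuclideanSpace ℝ (Fin n)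

theorem nontrivial_eucl {n : ℕ} (hn : 2 ≤ n) : Nontrivial (Eucl n) := by
  have : Nonempty (Fin n) := ⟨⟨0, by omega⟩⟩
  infer_instance

/-- The ring `{1/2 < |y| < 1}`. -/
def unitRing (n : ℕ) : Set (Eucl n) := Metric.ball 0 1 \ Metric.closedBall 0 (1 / 2)

theorem mem_unitRing {n : ℕ} {y : Eucl n} : y ∈ unitRing n ↔ 1 / 2 < ‖y‖ ∧ ‖y‖ < 1 := by
  simp [unitRing, and_comm]

theorem isOpen_unitRing (n : ℕ) : IsOpen (unitRing n) :=
  Metric.isOpen_ball.sdiff Metric.isClosed_closedBall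

theorem measurableSet_unitRing (n : ℕ) : MeasurableSet (unitRing n) :=
  (isOpen_unitRing n).measurableSet

theorem volume_unitRing_lt_top (n : ℕ) : volume (unitRing n) < ⊤ :=
  (measure_mono sdiff_subset).trans_lt measure_ball_lt_top

theorem volume_real_unitRing_pos {n : ℕ} (hn : 2 ≤ n) : 0 < volume.real (unitRing n) := by
  have := nontrivial_eucl hn
  refine ENNReal.toReal_pos ?_ (volume_unitRing_lt_top n).ne
  refine ((isOpen_unitRing n).measure_pos volume ?_).ne'
  obtain ⟨y, hy⟩ := exists_norm_eq (Eucl n) (c := 3 / 4) (by norm_num)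
  exact ⟨y, by rw [mem_unitRing, hy]; norm_num⟩

/-- The integral of `v` over the unit ring, transported to the centre `x` and the scale `a`. -/
noncomputable def ringMean {n : ℕ} (v : Eucl n → ℝ) (x : Eucl n) (a : ℝ) : ℝ :=
  ∫ y in unitRing n, v (x + a • y)

theorem continuous_gradient {n : ℕ} {φ : Eucl n → ℝ} (hφ : ContDiff ℝ ∞ φ) :
    Continuous (gradient φ) :=
  (InnerProductSpace.toDual ℝ (Eucl n)).symm.continuous.comp (hφ.continuous_fderiv (by simp))

theorem norm_gradient {n : ℕ} (φ : Eucl n → ℝ) (x : Eucl n) : ‖gradient φ x‖ = ‖fderiv ℝ φ x‖ :=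
  LinearIsometryEquiv.norm_map _ _

/-- Affine homeomorphism `y ↦ z + b y`. -/
noncomputable def affineHomeo {n : ℕ} (z : Eucl n) {b : ℝ} (hb : b ≠ 0) : Eucl n ≃ₜ Eucl n :=
  (Homeomorph.smulOfNeZero b hb).trans (Homeomorph.addLeft z)

theorem affineHomeo_apply {n : ℕ} (z : Eucl n) {b : ℝ} (hb : b ≠ 0) (y : Eucl n) :
    affineHomeo z hb y = z + b • y := rfl

theorem map_affineHomeo {n : ℕ} (z : Eucl n) {b : ℝ} (hb : 0 < b) :
    Measure.map (affineHomeo z hb.ne') volume =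
      ENNReal.ofReal ((b ^ n)⁻¹) • (volume : Measure (Eucl n)) := by
  have h1 : (affineHomeo z hb.ne' : Eucl n → Eucl n) = (fun y => z + y) ∘ (fun y => b • y) := rfl
  rw [h1, ← Measure.map_map (measurable_const_add z) (measurable_const_smul b),
    Measure.map_addHaar_smul _ hb.ne', Measure.map_smul, map_add_left_eq_self,
    finrank_euclideanSpace_fin, abs_of_pos (by positivity)]

/-- The exponent equals the dimension, so the Jacobian b^{-n} leaves the norm as b^{-1}. For a
gradient this cancels the factor b of a displacement proportional to the scale. -/
theorem eLpNorm_comp_affine_le {n : ℕ} (hn : n ≠ 0) {F : Type*} [NormedAddCommGroup F]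
    (g : Eucl n → F) (z : Eucl n) {b : ℝ} (hb : 0 < b) {D U : Set (Eucl n)}
    (hD : MeasurableSet D) (hU : MeasurableSet U) (hDU : ∀ y ∈ D, z + b • y ∈ U) :
    eLpNorm (fun y => g (z + b • y)) n (volume.restrict D) ≤
      ENNReal.ofReal b⁻¹ * eLpNorm g n (volume.restrict U) := by
  have hn0 : (n : ℝ≥0∞) ≠ 0 := by exact_mod_cast hn
  have hnR : (n : ℝ) ≠ 0 := by exact_mod_cast hn
  rw [eLpNorm_eq_lintegral_rpow_enorm_toReal hn0 (by simp),
    eLpNorm_eq_lintegral_rpow_enorm_toReal hn0 (by simp), ENNReal.toReal_natCast]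
  have h1 : ∫⁻ y in D, ‖g (z + b • y)‖ₑ ^ (n : ℝ) ≤
      ENNReal.ofReal ((b ^ n)⁻¹) * ∫⁻ y in U, ‖g y‖ₑ ^ (n : ℝ) := by
    rw [← lintegral_indicator hU, ← smul_eq_mul, ← lintegral_smul_measure, ← map_affineHomeo z hb,
      (affineHomeo z hb.ne').measurableEmbedding.lintegral_map, ← lintegral_indicator hD]
    refine lintegral_mono fun y => ?_
    by_cases hy : y ∈ D
    · rw [indicator_of_mem hy, affineHomeo_apply, indicator_of_mem (hDU y hy)]
    · rw [indicator_of_notMem hy]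
      exact zero_le
  calc _ ≤ (ENNReal.ofReal ((b ^ n)⁻¹) * ∫⁻ y in U, ‖g y‖ₑ ^ (n : ℝ)) ^ (1 / (n : ℝ)) := by gcongr
    _ = _ := by
      rw [ENNReal.mul_rpow_of_nonneg _ _ (by positivity), ← inv_pow,
        ENNReal.ofReal_pow (by positivity), ← ENNReal.rpow_natCast, ← ENNReal.rpow_mul,
        mul_one_div_cancel hnR, ENNReal.rpow_one]

/-- The Hölder constant of the unit ring. -/
noncomputable def ringConst (n : ℕ) : ℝ := volume.real (unitRing n) ^ (1 - 1 / (n : ℝ))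

theorem ringConst_nonneg (n : ℕ) : 0 ≤ ringConst n := Real.rpow_nonneg measureReal_nonneg _

theorem lintegral_ring_le {n : ℕ} (hn : n ≠ 0) {F : Type*} [NormedAddCommGroup F]
    {g : Eucl n → F} (hg : AEStronglyMeasurable g volume) (z : Eucl n) {b : ℝ} (hb : 0 < b)
    {U : Set (Eucl n)} (hU : MeasurableSet U) (hDU : ∀ y ∈ unitRing n, z + b • y ∈ U) :
    AEStronglyMeasurable (fun y => g (z + b • y)) (volume.restrict (unitRing n)) ∧
    ∫⁻ y in unitRing n, ‖g (z + b • y)‖ₑ ≤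
      ENNReal.ofReal (ringConst n * b⁻¹) * eLpNorm g n (volume.restrict U) := by
  have hmeas : AEStronglyMeasurable (fun y => g (z + b • y)) (volume : Measure (Eucl n)) := by
    have : AEStronglyMeasurable g (Measure.map (affineHomeo z hb.ne') volume) := by
      rw [map_affineHomeo z hb]
      exact hg.smul_measure _
    exact this.comp_measurable (affineHomeo z hb.ne').measurable
  refine ⟨hmeas.restrict, ?_⟩
  rw [← eLpNorm_one_eq_lintegral_enorm]
  have h1 := eLpNorm_le_eLpNorm_mul_rpow_measure_univ (p := 1) (q := n)
    (by exact_mod_cast Nat.one_le_iff_ne_zero.2 hn) (hmeas.restrict (s := unitRing n))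
  have h2 := eLpNorm_comp_affine_le hn g z hb (measurableSet_unitRing n) hU hDU
  have h3 : (volume.restrict (unitRing n) univ) ^ (1 / (1 : ℝ≥0∞).toReal - 1 / (n : ℝ≥0∞).toReal) =
      ENNReal.ofReal (ringConst n) := by
    rw [Measure.restrict_apply_univ, ringConst, ← ENNReal.ofReal_rpow_of_nonneg measureReal_nonneg,
      ofReal_measureReal (volume_unitRing_lt_top n).ne]
    · simp
    · rw [sub_nonneg, div_le_one (by positivity)]
      exact_mod_cast Nat.one_le_iff_ne_zero.2 hn
  rw [h3] at h1
  refine h1.trans ((mul_le_mul_left h2 _).trans (le_of_eq ?_))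
  rw [ENNReal.ofReal_mul (ringConst_nonneg n)]
  ring

theorem integrableOn_ring {n : ℕ} (hn : n ≠ 0) {F : Type*} [NormedAddCommGroup F]
    {g : Eucl n → F} (hg : MemLp g n volume) (z : Eucl n) {b : ℝ} (hb : 0 < b) :
    IntegrableOn (fun y => g (z + b • y)) (unitRing n) := by
  obtain ⟨h1, h2⟩ := lintegral_ring_le hn hg.1 z hb MeasurableSet.univ fun _ _ => mem_univ _
  refine ⟨h1, h2.trans_lt ?_⟩
  rw [Measure.restrict_univ]
  exact ENNReal.mul_lt_top ENNReal.ofReal_lt_top hg.2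

theorem integral_ring_le {n : ℕ} (hn : n ≠ 0) {F : Type*} [NormedAddCommGroup F]
    {g : Eucl n → F} (hg : MemLp g n volume) (z : Eucl n) {b : ℝ} (hb : 0 < b)
    {U : Set (Eucl n)} (hU : MeasurableSet U) (hDU : ∀ y ∈ unitRing n, z + b • y ∈ U) :
    ∫ y in unitRing n, ‖g (z + b • y)‖ ≤
      ringConst n * b⁻¹ * (eLpNorm g n (volume.restrict U)).toReal := by
  obtain ⟨h1, h2⟩ := lintegral_ring_le hn hg.1 z hb hU hDU
  rw [integral_norm_eq_lintegral_enorm h1]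
  have := ENNReal.toReal_mono (ENNReal.mul_ne_top ENNReal.ofReal_ne_top
    (hg.restrict U).2.ne) h2
  rwa [ENNReal.toReal_mul, ENNReal.toReal_ofReal (mul_nonneg (ringConst_nonneg n)
    (by positivity))] at this

/-- Centre and radius move along a segment; each point of the ring then moves with speed at most ‖x'
- x‖ + |a' - a|, and the average is differentiated under the integral sign. -/
theorem abs_ringMean_sub_le {n : ℕ} {φ : Eucl n → ℝ} (hφ : ContDiff ℝ ∞ φ)
    (hφc : HasCompactSupport φ) {x x' : Eucl n} {a a' K : ℝ}
    (hK : ∀ t ∈ Icc (0 : ℝ) 1,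
      ∫ y in unitRing n, ‖gradient φ (x + t • (x' - x) + (a + t * (a' - a)) • y)‖ ≤ K) :
    |ringMean φ x' a' - ringMean φ x a| ≤ (‖x' - x‖ + |a' - a|) * K := by
  set γ : ℝ → Eucl n → Eucl n := fun t y => x + t • (x' - x) + (a + t * (a' - a)) • y with hγ
  set w : Eucl n → Eucl n := fun y => (x' - x) + (a' - a) • y with hw
  have hγd : ∀ y t, HasDerivAt (fun t => γ t y) (w y) t := by
    intro y t
    have h1 : HasDerivAt (fun t : ℝ => x + t • (x' - x)) (x' - x) t := by
      simpa using ((hasDerivAt_id t).smul_const (x' - x)).const_add x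
    have h2 : HasDerivAt (fun t : ℝ => (a + t * (a' - a)) • y) ((a' - a) • y) t := by
      simpa using (((hasDerivAt_id t).mul_const (a' - a)).const_add a).smul_const y
    exact h1.add h2
  have hγc : ∀ t, Continuous (γ t) := by intro t; fun_prop
  have hwc : Continuous w := by fun_prop
  have hfc : Continuous (fderiv ℝ φ) := hφ.continuous_fderiv (by simp)
  obtain ⟨M, hM⟩ := hfc.bounded_above_of_compact_support (hφc.fderiv (𝕜 := ℝ))
  have hM0 : 0 ≤ M := (norm_nonneg _).trans (hM 0)
  have hwb : ∀ y ∈ unitRing n, ‖w y‖ ≤ ‖x' - x‖ + |a' - a| := by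
    intro y hy
    refine (norm_add_le _ _).trans ?_
    rw [norm_smul, Real.norm_eq_abs]
    have := (mem_unitRing.1 hy).2
    gcongr
    exact mul_le_of_le_one_right (abs_nonneg _) this.le
  have : IsFiniteMeasure (volume.restrict (unitRing n)) :=
    ⟨by rw [Measure.restrict_apply_univ]; exact volume_unitRing_lt_top n⟩
  set B : ℝ := ‖x' - x‖ + |a' - a| with hB
  have hB0 : 0 ≤ B := by positivity
  have hder : ∀ t : ℝ, HasDerivAt (fun t => ∫ y in unitRing n, φ (γ t y))
      (∫ y in unitRing n, fderiv ℝ φ (γ t y) (w y)) t := by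
    intro t
    obtain ⟨C, hC⟩ := hφ.continuous.bounded_above_of_compact_support hφc
    refine (hasDerivAt_integral_of_dominated_loc_of_deriv_le
      (F := fun t y => φ (γ t y)) (F' := fun t y => fderiv ℝ φ (γ t y) (w y))
      (bound := fun _ => M * B) (Filter.univ_mem (f := 𝓝 t))
      (Eventually.of_forall fun s => (hφ.continuous.comp (hγc s)).aestronglyMeasurable)
      ?_ ?_ ?_ (integrable_const _) ?_).2
    · exact Integrable.of_bound (hφ.continuous.comp (hγc t)).aestronglyMeasurable C
        (Eventually.of_forall fun y => hC _)
    · exact ((hfc.comp (hγc t)).clm_apply hwc).aestronglyMeasurable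
    · refine (ae_restrict_iff' (measurableSet_unitRing n)).2 (Eventually.of_forall ?_)
      intro y hy s _
      exact (ContinuousLinearMap.le_opNorm _ _).trans
        (mul_le_mul (hM _) (hwb y hy) (norm_nonneg _) hM0)
    · refine Eventually.of_forall fun y s _ => ?_
      exact ((hφ.differentiable (by simp)).differentiableAt.hasFDerivAt).comp_hasDerivAt s (hγd y s)
  have hbound : ∀ t ∈ Ico (0 : ℝ) 1, ‖∫ y in unitRing n, fderiv ℝ φ (γ t y) (w y)‖ ≤ B * K := by
    intro t ht
    refine (norm_integral_le_integral_norm _).trans ?_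
    have h1 : ∫ y in unitRing n, ‖fderiv ℝ φ (γ t y) (w y)‖ ≤
        ∫ y in unitRing n, B * ‖gradient φ (γ t y)‖ := by
      refine setIntegral_mono_on ?_ ?_ (measurableSet_unitRing n) ?_
      · refine Integrable.of_bound
          ((hfc.comp (hγc t)).clm_apply hwc).norm.aestronglyMeasurable (M * B) ?_
        refine (ae_restrict_iff' (measurableSet_unitRing n)).2 (Eventually.of_forall ?_)
        intro y hy
        rw [norm_norm]
        exact (ContinuousLinearMap.le_opNorm _ _).trans
          (mul_le_mul (hM _) (hwb y hy) (norm_nonneg _) hM0)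
      · refine (Integrable.of_bound (C := M)
          (((continuous_gradient hφ).comp (hγc t)).norm.aestronglyMeasurable) ?_).const_mul B
        refine Eventually.of_forall fun y => ?_
        rw [norm_norm, Function.comp, norm_gradient]
        exact hM _
      · intro y hy
        rw [norm_gradient, mul_comm]
        exact (ContinuousLinearMap.le_opNorm _ _).trans
          (mul_le_mul_of_nonneg_left (hwb y hy) (norm_nonneg _))
    refine h1.trans ?_
    rw [integral_const_mul]
    exact mul_le_mul_of_nonneg_left (hK t ⟨ht.1, ht.2.le⟩) hB0
  have := norm_image_sub_le_of_norm_deriv_le_segment_01'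
    (f := fun t => ∫ y in unitRing n, φ (γ t y)) (fun t _ => (hder t).hasDerivWithinAt) hbound
  simpa [hγ, ringMean] using this

/-- `v` with the weak gradient `G` is a limit of smooth compactly supported functions in
`W^{1,n}`. -/
structure IsSobolevLimit {n : ℕ} (v : Eucl n → ℝ) (G : Eucl n → Eucl n) : Prop where
  memLp : MemLp v n volume
  memLp_grad : MemLp G n volume
  exists_approx : ∀ ε : ℝ≥0∞, 0 < ε → ∃ φ : Eucl n → ℝ, ContDiff ℝ ∞ φ ∧ HasCompactSupport φ ∧
    eLpNorm (v - φ) n volume < ε ∧ eLpNorm (G - gradient φ) n volume < ε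

/-- The Dirichlet energy `U ↦ ∫_U |G|^n` as a measure. -/
noncomputable def energy {n : ℕ} (G : Eucl n → Eucl n) : Measure (Eucl n) :=
  volume.withDensity fun x => ‖G x‖ₑ ^ n

theorem isFiniteMeasure_energy {n : ℕ} (hn : n ≠ 0) {G : Eucl n → Eucl n} (hG : MemLp G n volume) :
    IsFiniteMeasure (energy G) := by
  refine isFiniteMeasure_withDensity ?_
  have := lintegral_rpow_enorm_lt_top_of_eLpNorm_lt_top (p := n) (by exact_mod_cast hn) (by simp)
    hG.2
  simpa using this.ne

theorem toReal_eLpNorm_restrict {n : ℕ} (hn : n ≠ 0) {G : Eucl n → Eucl n} {U : Set (Eucl n)}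
    (hU : MeasurableSet U) :
    (eLpNorm G n (volume.restrict U)).toReal = (energy G).real U ^ (1 / (n : ℝ)) := by
  rw [eLpNorm_eq_lintegral_rpow_enorm_toReal (by exact_mod_cast hn) (by simp), energy,
    measureReal_def, withDensity_apply _ hU, ENNReal.toReal_rpow]
  simp

/-- The smooth estimate passes to the Sobolev limit, and Hölder's inequality on the ring turns the
integral of |G| into energy. Only the displacement relative to the smallest radius `b` matters, and
only the energy of the region `U` swept by the rings. -/
theorem abs_ringMean_sub_le_energy {n : ℕ} (hn : n ≠ 0) {v : Eucl n → ℝ} {G : Eucl n → Eucl n}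
    (h : IsSobolevLimit v G) {x x' : Eucl n} {a a' b : ℝ} (hb : 0 < b) (ha : b ≤ a) (ha' : b ≤ a')
    {U : Set (Eucl n)} (hU : MeasurableSet U)
    (hxU : ∀ t ∈ Icc (0 : ℝ) 1, ∀ y ∈ unitRing n,
      x + t • (x' - x) + (a + t * (a' - a)) • y ∈ U) :
    |ringMean v x' a' - ringMean v x a| ≤
      ringConst n * ((‖x' - x‖ + |a' - a|) / b) * (energy G).real U ^ (1 / (n : ℝ)) := by
  rw [← toReal_eLpNorm_restrict hn hU]
  have hC := ringConst_nonneg n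
  set C := ringConst n
  set N := (eLpNorm G n (volume.restrict U)).toReal with hN
  set B := ‖x' - x‖ + |a' - a| with hB
  have hB0 : 0 ≤ B := by positivity
  have hn1 : (1 : ℝ≥0∞) ≤ n := by exact_mod_cast Nat.one_le_iff_ne_zero.2 hn
  -- Replacing v by a smooth function costs a multiple of ε three times: in each of the two ring
  -- averages and in the norm of the gradient on `U`.
  have key : ∀ ε : ℝ, 0 < ε → |ringMean v x' a' - ringMean v x a| ≤
      C * (B / b) * N + (C * (B / b) + 2 * (C * b⁻¹)) * ε := by
    intro ε hε
    obtain ⟨φ, hφ, hφc, h1, h2⟩ := h.exists_approx (ENNReal.ofReal ε) (by simpa using hε)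
    have hφL : MemLp φ n volume := hφ.continuous.memLp_of_hasCompactSupport hφc
    have hgc : HasCompactSupport (gradient φ) :=
      (hφc.fderiv (𝕜 := ℝ)).comp_left (g := (InnerProductSpace.toDual ℝ (Eucl n)).symm) (map_zero _)
    have hgL : MemLp (gradient φ) n volume :=
      (continuous_gradient hφ).memLp_of_hasCompactSupport hgc
    have hdiff : ∀ z : Eucl n, ∀ s : ℝ, b ≤ s → |ringMean v z s - ringMean φ z s| ≤ C * b⁻¹ * ε := by
      intro z s hs
      have hs0 : 0 < s := hb.trans_le hs
      rw [ringMean, ringMean, ← integral_sub (integrableOn_ring hn h.memLp z hs0)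
        (integrableOn_ring hn hφL z hs0), ← Real.norm_eq_abs]
      refine (norm_integral_le_integral_norm _).trans ?_
      have h3 := integral_ring_le hn (h.memLp.sub hφL) z hs0 MeasurableSet.univ
        fun _ _ => mem_univ _
      rw [Measure.restrict_univ] at h3
      refine h3.trans ?_
      have h4 : (eLpNorm (v - φ) n volume).toReal ≤ ε := ENNReal.toReal_le_of_le_ofReal hε.le h1.le
      gcongr
    have hK : (eLpNorm (gradient φ) n (volume.restrict U)).toReal ≤ N + ε := by
      have h3 : eLpNorm (gradient φ) n (volume.restrict U) ≤
          eLpNorm G n (volume.restrict U) + eLpNorm (G - gradient φ) n (volume.restrict U) := by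
        have h4 := eLpNorm_sub_le (p := n) (h.memLp_grad.restrict U).1
          ((h.memLp_grad.sub hgL).restrict U).1 hn1
        simpa using h4
      have h5 : eLpNorm (G - gradient φ) n (volume.restrict U) ≤ ENNReal.ofReal ε :=
        (eLpNorm_restrict_le _ _ _ _).trans h2.le
      refine (ENNReal.toReal_mono ?_ (h3.trans (add_le_add_right h5 _))).trans ?_
      · exact ENNReal.add_ne_top.2 ⟨(h.memLp_grad.restrict U).2.ne, ENNReal.ofReal_ne_top⟩
      · rw [ENNReal.toReal_add (h.memLp_grad.restrict U).2.ne ENNReal.ofReal_ne_top,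
          ENNReal.toReal_ofReal hε.le]
    have hmain : |ringMean φ x' a' - ringMean φ x a| ≤ B * (C * b⁻¹ * (N + ε)) := by
      refine abs_ringMean_sub_le hφ hφc fun t ht => ?_
      have hbt : b ≤ a + t * (a' - a) := by nlinarith [ht.1, ht.2]
      refine (integral_ring_le hn hgL _ (hb.trans_le hbt) hU (hxU t ht)).trans ?_
      have : 0 ≤ N + ε := by positivity
      gcongr
    have e1 := abs_le.1 (hdiff x a ha)
    have e2 := abs_le.1 (hdiff x' a' ha')
    have e3 := abs_le.1 hmain
    have e4 : B * (C * b⁻¹ * (N + ε)) + 2 * (C * b⁻¹ * ε) =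
      C * (B / b) * N + (C * (B / b) + 2 * (C * b⁻¹)) * ε := by ring
    rw [← e4, abs_le]
    constructor <;> linarith [e1.1, e1.2, e2.1, e2.2, e3.1, e3.2]
  refine le_of_forall_pos_le_add fun δ hδ => ?_
  set X := C * (B / b) + 2 * (C * b⁻¹) with hX
  have hX0 : 0 ≤ X := by positivity
  refine (key (δ / (X + 1)) (by positivity)).trans ?_
  gcongr
  rw [mul_div_assoc', div_le_iff₀ (by positivity)]
  nlinarith

end RingMean

/-! ### Pointwise bounds by dyadic telescoping -/

section Pointwise

theorem tendsto_ringMean {n : ℕ} (hn : n ≠ 0) {v : Eucl n → ℝ} (hv : MemLp v n volume)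
    {x : Eucl n} (hx : ContinuousAt v x) :
    Tendsto (ringMean v x) (𝓝[>] 0) (𝓝 (v x * volume.real (unitRing n))) := by
  rw [Metric.tendsto_nhds]
  intro ε hε
  set d := volume.real (unitRing n) with hd
  have hd0 : 0 ≤ d := measureReal_nonneg
  obtain ⟨δ, hδ, hball⟩ := Metric.continuousAt_iff.1 hx (ε / (d + 1)) (by positivity)
  filter_upwards [self_mem_nhdsWithin, mem_nhdsWithin_of_mem_nhds (Iio_mem_nhds hδ)] with a ha haδ
  have ha0 : 0 < a := ha
  have h1 : ringMean v x a - v x * d = ∫ y in unitRing n, (v (x + a • y) - v x) := by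
    rw [integral_sub (integrableOn_ring hn hv x ha0)
      (integrableOn_const (volume_unitRing_lt_top n).ne), setIntegral_const, ringMean, smul_eq_mul,
      mul_comm]
  rw [Real.dist_eq, h1, ← Real.norm_eq_abs]
  have h2 : ‖∫ y in unitRing n, (v (x + a • y) - v x)‖ ≤ ε / (d + 1) * d := by
    refine norm_setIntegral_le_of_norm_le_const (volume_unitRing_lt_top n) fun y hy => ?_
    have h3 : dist (x + a • y) x < δ := by
      rw [dist_eq_norm, add_sub_cancel_left, norm_smul, Real.norm_eq_abs, abs_of_pos ha0]
      have := (mem_unitRing.1 hy).2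
      have h4 : a < δ := haδ
      nlinarith
    exact (hball h3).le
  refine h2.trans_lt ?_
  rw [div_mul_eq_mul_div, div_lt_iff₀ (by positivity)]
  nlinarith

/-- Hölder's inequality for sums. The power K^{n-1} under the n-th root is the source of the
exponent n/(n-1) in the exponential estimate. -/
theorem sum_rpow_inv_le {n : ℕ} (hn : n ≠ 0) {s : ℕ → ℝ} (hs : ∀ k, 0 ≤ s k) (K : ℕ) :
    ∑ k ∈ Finset.range K, s k ^ (1 / (n : ℝ)) ≤
      ((K : ℝ) ^ (n - 1) * ∑ k ∈ Finset.range K, s k) ^ (1 / (n : ℝ)) := by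
  obtain ⟨m, rfl⟩ := Nat.exists_eq_succ_of_ne_zero hn
  have h0 : ∀ k, 0 ≤ s k ^ (1 / ((m + 1 : ℕ) : ℝ)) := fun k => Real.rpow_nonneg (hs k) _
  have hpow : ∀ k, (s k ^ (1 / ((m + 1 : ℕ) : ℝ))) ^ (m + 1) = s k := fun k => by
    rw [one_div, Real.rpow_inv_natCast_pow (hs k) (by omega)]
  have h1 := pow_sum_le_card_mul_sum_pow (s := Finset.range K) (fun k _ => h0 k) m
  simp only [hpow, Finset.card_range] at h1
  have h2 : 0 ≤ ∑ k ∈ Finset.range K, s k ^ (1 / ((m + 1 : ℕ) : ℝ)) :=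
    Finset.sum_nonneg fun k _ => h0 k
  have h3 := Real.rpow_le_rpow (by positivity) h1 (z := 1 / ((m + 1 : ℕ) : ℝ)) (by positivity)
  have h4 := Real.pow_rpow_inv_natCast h2 (n := m + 1) (by omega)
  rw [← one_div] at h4
  rwa [h4] at h3

/-- The sum of the geometric series of ratio `2 ^ (-1/n)`. -/
noncomputable def geomConst (n : ℕ) : ℝ := (1 - (1 / 2 : ℝ) ^ (1 / (n : ℝ)))⁻¹

theorem half_rpow_lt_one {n : ℕ} (hn : n ≠ 0) : (1 / 2 : ℝ) ^ (1 / (n : ℝ)) < 1 :=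
  Real.rpow_lt_one (by norm_num) (by norm_num) (by positivity)

theorem geomConst_pos {n : ℕ} (hn : n ≠ 0) : 0 < geomConst n :=
  inv_pos.2 (sub_pos.2 (half_rpow_lt_one hn))

theorem sum_half_rpow_le {n : ℕ} (hn : n ≠ 0) (N : ℕ) :
    ∑ i ∈ Finset.range N, ((1 / 2 : ℝ) ^ i) ^ (1 / (n : ℝ)) ≤ geomConst n := by
  have h0 : (0 : ℝ) ≤ (1 / 2 : ℝ) ^ (1 / (n : ℝ)) := by positivity
  have h1 : ∀ i : ℕ, ((1 / 2 : ℝ) ^ i) ^ (1 / (n : ℝ)) = ((1 / 2 : ℝ) ^ (1 / (n : ℝ))) ^ i := by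
    intro i
    rw [← Real.rpow_natCast, ← Real.rpow_natCast, ← Real.rpow_mul (by norm_num),
      ← Real.rpow_mul (by norm_num), mul_comm]
  simp only [h1]
  rw [geomConst, ← tsum_geometric_of_lt_one h0 (half_rpow_lt_one hn)]
  exact (summable_geometric_of_lt_one h0 (half_rpow_lt_one hn)).sum_le_tsum _
    fun i _ => pow_nonneg h0 i

/-- The ring averages at radii R/2^k converge to v(x) times the volume of the ring, so v(x) is a
telescoping sum. The first `K` increments are summed by Hölder using only the total energy; the
later ones form a geometric series by the assumed decay. -/
theorem abs_mul_le_of_energy_decay {n : ℕ} (hn : n ≠ 0) {v : Eucl n → ℝ} {G : Eucl n → Eucl n}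
    (h : IsSobolevLimit v G) {x : Eucl n} (hx : ContinuousAt v x) {R θ : ℝ} (hR : 0 < R)
    (hθ : 0 ≤ θ) {K : ℕ}
    (hK : ∀ k : ℕ, (energy G).real (Metric.closedBall x (R * (1 / 2) ^ (K + k))) ≤
      θ * (1 / 2) ^ k) :
    |v x| * volume.real (unitRing n) ≤ |ringMean v x R| + ringConst n *
      (((K : ℝ) ^ (n - 1) * (2 * (energy G).real (Metric.closedBall x R))) ^ (1 / (n : ℝ)) +
        θ ^ (1 / (n : ℝ)) * geomConst n) := by
  have := isFiniteMeasure_energy hn h.memLp_grad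
  have hC := ringConst_nonneg n
  set C := ringConst n
  set β : ℕ → ℝ := fun k => (energy G).real (Metric.closedBall x (R * (1 / 2) ^ k)) with hβ
  set M : ℕ → ℝ := fun k => ringMean v x (R * (1 / 2) ^ k) with hM
  have hβ0 : ∀ k, 0 ≤ β k := fun k => measureReal_nonneg
  have hβa : ∀ k, β (k + 1) ≤ β k := fun k => by
    refine measureReal_mono (Metric.closedBall_subset_closedBall ?_)
    rw [pow_succ]
    have : (0 : ℝ) ≤ R * (1 / 2) ^ k := by positivity
    linarith
  -- All rings between the radii R/2^k and R/2^{k+1} lie in the annulus from R/2^{k+2} to R/2^k,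
  -- whose energy is `s k`. Every point is in at most two of these annuli, whence the factor 2 in
  -- the sum.
  set s : ℕ → ℝ := fun k => β k - β (k + 2) with hs
  have hs0 : ∀ k, 0 ≤ s k := fun k => sub_nonneg.2 ((hβa (k + 1)).trans (hβa k))
  have hstep : ∀ k, |M (k + 1) - M k| ≤ C * s k ^ (1 / (n : ℝ)) := by
    intro k
    have hpos : (0 : ℝ) < R * (1 / 2) ^ k := by positivity
    have e1 : R * (1 / 2) ^ (k + 1) = R * (1 / 2) ^ k / 2 := by rw [pow_succ]; ring
    have e2 : R * (1 / 2) ^ (k + 2) = R * (1 / 2) ^ k / 4 := by rw [pow_add]; ring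
    have h1 := abs_ringMean_sub_le_energy hn h (x := x) (x' := x) (a := R * (1 / 2) ^ k)
      (a' := R * (1 / 2) ^ (k + 1)) (b := R * (1 / 2) ^ (k + 1)) (by positivity)
      (by rw [e1]; linarith) le_rfl
      (U := Metric.closedBall x (R * (1 / 2) ^ k) \ Metric.closedBall x (R * (1 / 2) ^ (k + 2)))
      (Metric.isClosed_closedBall.measurableSet.diff Metric.isClosed_closedBall.measurableSet) ?_
    · rw [measureReal_sdiff (Metric.closedBall_subset_closedBall (by rw [e2]; linarith))
        Metric.isClosed_closedBall.measurableSet, sub_self, norm_zero, zero_add] at h1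
      refine h1.trans (le_of_eq ?_)
      have e3 : |R * (1 / 2) ^ (k + 1) - R * (1 / 2) ^ k| / (R * (1 / 2) ^ (k + 1)) = 1 := by
        rw [e1, abs_sub_comm, abs_of_pos (by linarith)]
        field_simp
        ring
      rw [e3, mul_one]
    · intro t ht y hy
      obtain ⟨hy1, hy2⟩ := mem_unitRing.1 hy
      set q := R * (1 / 2) ^ k with hq
      rw [e1, e2]
      have hf : q / 2 ≤ q + t * (q / 2 - q) := by nlinarith [ht.1, ht.2]
      have hf' : q + t * (q / 2 - q) ≤ q := by nlinarith [ht.1, ht.2]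
      have hnorm : dist (x + t • (x - x) + (q + t * (q / 2 - q)) • y) x =
          (q + t * (q / 2 - q)) * ‖y‖ := by
        rw [sub_self, smul_zero, add_zero, dist_eq_norm, add_sub_cancel_left, norm_smul,
          Real.norm_eq_abs, abs_of_nonneg (by linarith)]
      refine ⟨?_, ?_⟩
      · rw [Metric.mem_closedBall, hnorm]
        nlinarith
      · rw [Metric.mem_closedBall, hnorm, not_le]
        nlinarith
  have hsum1 : ∀ N, |M N| ≤ |M 0| + C * ∑ k ∈ Finset.range N, s k ^ (1 / (n : ℝ)) := by
    intro N
    induction N with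
    | zero => simp
    | succ N ih =>
      rw [Finset.sum_range_succ, mul_add]
      have h1 := hstep N
      have h2 := abs_sub_abs_le_abs_sub (M (N + 1)) (M N)
      linarith
  have hsum2 : ∑ k ∈ Finset.range K, s k ≤ 2 * β 0 := by
    have : ∀ N, ∑ k ∈ Finset.range N, s k = β 0 + β 1 - β N - β (N + 1) := by
      intro N
      induction N with
      | zero => simp
      | succ N ih => rw [Finset.sum_range_succ, ih, hs]; ring
    rw [this]
    linarith [hβa 0, hβ0 K, hβ0 (K + 1)]
  have hβ00 : β 0 = (energy G).real (Metric.closedBall x R) := by simp [hβ]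
  have hbd : ∀ N, |M (K + N)| ≤ |ringMean v x R| + C *
      (((K : ℝ) ^ (n - 1) * (2 * (energy G).real (Metric.closedBall x R))) ^ (1 / (n : ℝ)) +
        θ ^ (1 / (n : ℝ)) * geomConst n) := by
    intro N
    refine (hsum1 (K + N)).trans ?_
    have e0 : M 0 = ringMean v x R := by simp [hM]
    rw [e0, Finset.sum_range_add]
    gcongr
    · refine (sum_rpow_inv_le hn hs0 K).trans ?_
      rw [← hβ00]
      have := Finset.sum_nonneg (s := Finset.range K) fun k _ => hs0 k
      gcongr
    · calc ∑ i ∈ Finset.range N, s (K + i) ^ (1 / (n : ℝ))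
          ≤ ∑ i ∈ Finset.range N, θ ^ (1 / (n : ℝ)) * ((1 / 2 : ℝ) ^ i) ^ (1 / (n : ℝ)) := by
            refine Finset.sum_le_sum fun i _ => ?_
            rw [← Real.mul_rpow hθ (by positivity)]
            refine Real.rpow_le_rpow (hs0 _) ?_ (by positivity)
            exact (sub_le_self _ (hβ0 _)).trans (hK i)
        _ ≤ _ := by
            rw [← Finset.mul_sum]
            exact mul_le_mul_of_nonneg_left (sum_half_rpow_le hn N) (by positivity)
  have hlim : Tendsto (fun N => |M (K + N)|) atTop (𝓝 (|v x| * volume.real (unitRing n))) := by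
    have h1 : Tendsto (fun N : ℕ => R * (1 / 2 : ℝ) ^ (K + N)) atTop (𝓝[>] 0) := by
      refine tendsto_nhdsWithin_iff.2 ⟨?_, Eventually.of_forall fun N => ?_⟩
      · have h2 := (tendsto_pow_atTop_nhds_zero_of_lt_one (r := (1 / 2 : ℝ)) (by norm_num)
          (by norm_num)).const_mul (R * (1 / 2) ^ K)
        rw [mul_zero] at h2
        refine h2.congr fun N => ?_
        rw [pow_add, mul_assoc]
      · have : (0 : ℝ) < R * (1 / 2) ^ (K + N) := by positivity
        exact this
    have h2 := ((tendsto_ringMean hn h.memLp hx).comp h1).abs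
    rwa [abs_mul, abs_of_nonneg (a := volume.real (unitRing n)) measureReal_nonneg] at h2
  exact le_of_tendsto' hlim hbd

end Pointwise

/-! ### Vitali coverings: the cost of crossing and the size of level sets -/

section Covering

/-- Vitali covering: an outer measure that is dominated by `ν` on suitable balls around the points
of `S` is dominated by `ν` on `S`. -/
theorem outerMeasure_le_of_ball_le {n : ℕ} (m : OuterMeasure (Eucl n)) (ν : Measure (Eucl n))
    {S U : Set (Eucl n)} {ρ : Eucl n → ℝ} {R : ℝ} {c : ℝ≥0∞} (hρ : ∀ x ∈ S, 0 < ρ x)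
    (hρR : ∀ x ∈ S, ρ x ≤ R) (hU : ∀ x ∈ S, Metric.closedBall x (ρ x) ⊆ U)
    (hm : ∀ x ∈ S, m (Metric.closedBall x (5 * ρ x)) ≤ c * ν (Metric.closedBall x (ρ x))) :
    m S ≤ c * ν U := by
  obtain ⟨T, hTS, hTd, hTc⟩ := Vitali.exists_disjoint_subfamily_covering_enlargement_closedBall
    S id ρ R hρR 5 (by norm_num)
  have hcount : T.Countable := by
    refine hTd.countable_of_nonempty_interior fun x hx => ?_
    exact ⟨x, Metric.ball_subset_interior_closedBall (Metric.mem_ball_self (hρ x (hTS hx)))⟩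
  calc m S ≤ m (⋃ x ∈ T, Metric.closedBall x (5 * ρ x)) := by
        refine measure_mono fun x hx => ?_
        obtain ⟨y, hy, hxy⟩ := hTc x hx
        exact mem_iUnion₂.2 ⟨y, hy, hxy (Metric.mem_closedBall_self (hρ x hx).le)⟩
    _ ≤ ∑' x : T, m (Metric.closedBall (x : Eucl n) (5 * ρ x)) :=
        measure_biUnion_le m hcount _
    _ ≤ ∑' x : T, c * ν (Metric.closedBall (x : Eucl n) (ρ x)) :=
        ENNReal.tsum_le_tsum fun x => hm x (hTS x.2)
    _ = c * ν (⋃ x ∈ T, Metric.closedBall x (ρ x)) := by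
        rw [ENNReal.tsum_mul_left]
        exact congrArg (c * ·) (measure_biUnion hcount hTd
          fun x _ => Metric.isClosed_closedBall.measurableSet).symm
    _ ≤ c * ν U := by
        gcongr
        exact iUnion₂_subset fun x hx => hU x (hTS hx)

/-- At each point of `A` in the shell the dyadic decay with `K` = 0 must fail, for otherwise v < 1
there. This yields balls whose radius is controlled by R times their energy; their images under the
distance to `p` cover an interval of length `l`. -/
theorem exists_crossing_const {n : ℕ} (hn : 2 ≤ n) : ∃ c : ℝ, 0 < c ∧
    ∀ (v : Eucl n → ℝ) (G : Eucl n → Eucl n), IsSobolevLimit v G →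
    ∀ (A U : Set (Eucl n)) (p : Eucl n) (a l R : ℝ), 0 < R →
      (∀ s ∈ Ioo a (a + l), ∃ x ∈ A, dist x p = s) →
      (∀ x ∈ A, dist x p ∈ Ioo a (a + l) → ContinuousAt v x ∧ 1 ≤ v x ∧
        |ringMean v x R| ≤ volume.real (unitRing n) / 4 ∧ Metric.closedBall x R ⊆ U) →
      l ≤ c * R * (energy G).real U := by
  have hn0 : n ≠ 0 := by omega
  have hd := volume_real_unitRing_pos hn
  set d := volume.real (unitRing n) with hd'
  have hC := ringConst_nonneg n
  have hS := geomConst_pos hn0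
  -- Chosen so that under decay with θ = q^n the geometric series contributes at most d/4; with at
  -- most d/4 from the ring average this contradicts |v| ≥ 1.
  set q := d / (4 * (ringConst n * geomConst n + 1)) with hq
  have hq0 : 0 < q := by positivity
  -- A ball of radius 5ρ projects into an interval of length 10ρ, where ρ = R/2^k and the ball of
  -- radius ρ has energy above q^n/2^k.
  refine ⟨10 / q ^ n, by positivity, ?_⟩
  intro v G h A U p a l R hR hA hAU
  have := isFiniteMeasure_energy hn0 h.memLp_grad
  set S := {x ∈ A | dist x p ∈ Ioo a (a + l)} with hSdef
  have hk : ∀ x ∈ S, ∃ k : ℕ, q ^ n * (1 / 2) ^ k <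
      (energy G).real (Metric.closedBall x (R * (1 / 2) ^ k)) := by
    intro x hx
    obtain ⟨h1, h2, h3, h4⟩ := hAU x hx.1 hx.2
    by_contra! hcon
    have h5 := abs_mul_le_of_energy_decay hn0 h h1 hR (θ := q ^ n) (by positivity) (K := 0)
      (by simpa only [zero_add] using hcon)
    rw [Nat.cast_zero, zero_pow (by omega), zero_mul, Real.zero_rpow (by positivity), zero_add,
      one_div (n : ℝ), Real.pow_rpow_inv_natCast hq0.le hn0] at h5
    have h6 : ringConst n * (q * geomConst n) ≤ d / 4 := by
      have : ringConst n * (q * geomConst n) = q * (ringConst n * geomConst n) := by ring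
      rw [this, hq, div_mul_eq_mul_div, div_le_div_iff₀ (by positivity) (by positivity)]
      nlinarith
    have h7 : d ≤ |v x| * d := le_mul_of_one_le_left hd.le (h2.trans (le_abs_self _))
    linarith
  choose! k hk using hk
  have hle1 : ∀ k : ℕ, R * (1 / 2) ^ k ≤ R := fun k =>
    mul_le_of_le_one_right hR.le (pow_le_one₀ (by norm_num) (by norm_num))
  have hmain := outerMeasure_le_of_ball_le
    (OuterMeasure.comap (fun x => dist x p) (volume : Measure ℝ).toOuterMeasure) (energy G)
    (S := S) (U := U) (ρ := fun x => R * (1 / 2) ^ k x) (R := R)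
    (c := ENNReal.ofReal (10 / q ^ n * R)) (fun x _ => by positivity) (fun x _ => hle1 _)
    (fun x hx => (Metric.closedBall_subset_closedBall (hle1 _)).trans (hAU x hx.1 hx.2).2.2.2) ?_
  · rw [OuterMeasure.comap_apply] at hmain
    have h1 : Ioo a (a + l) ⊆ (fun x => dist x p) '' S := by
      intro s hs
      obtain ⟨x, hx, hxs⟩ := hA s hs
      exact ⟨x, ⟨hx, by rwa [hxs]⟩, hxs⟩
    have h2 : ENNReal.ofReal l ≤ ENNReal.ofReal (10 / q ^ n * R) * energy G U := by
      calc ENNReal.ofReal l = volume (Ioo a (a + l)) := by rw [Real.volume_Ioo]; congr 1; ring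
        _ ≤ _ := (measure_mono h1).trans hmain
    rw [← ofReal_measureReal (μ := energy G) (s := U), ← ENNReal.ofReal_mul (by positivity)] at h2
    exact (ENNReal.ofReal_le_ofReal_iff (by positivity)).1 h2
  · intro x hx
    rw [OuterMeasure.comap_apply]
    set ρ := R * (1 / 2 : ℝ) ^ k x with hρ
    have h1 : (fun y => dist y p) '' Metric.closedBall x (5 * ρ) ⊆
        Icc (dist x p - 5 * ρ) (dist x p + 5 * ρ) := by
      rintro _ ⟨y, hy, rfl⟩
      have h2 := abs_le.1 ((abs_dist_sub_le y x p).trans (Metric.mem_closedBall.1 hy))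
      exact ⟨by linarith [h2.1], by linarith [h2.2]⟩
    refine (measure_mono h1).trans ?_
    rw [← ofReal_measureReal (μ := energy G), ← ENNReal.ofReal_mul (by positivity)]
    change volume (Icc _ _) ≤ _
    rw [Real.volume_Icc]
    refine ENNReal.ofReal_le_ofReal ?_
    have h3 := (hk x hx).le
    calc dist x p + 5 * ρ - (dist x p - 5 * ρ) = 10 / q ^ n * R * (q ^ n * (1 / 2) ^ k x) := by
          rw [hρ]; field_simp; ring
      _ ≤ _ := by gcongr

/-- Where |v| exceeds the threshold, decay from scale `K` on must fail, so there is a ball of radius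
ρ = R/2^{K+k} with energy above η^n/2^k. Its volume is at most a constant times 2^{-K} 2^{-k}, hence
2^{-K} times its energy over η^n, and Vitali's covering sums this up. -/
theorem volume_superlevel_le {n : ℕ} (hn : 2 ≤ n) {R m : ℝ} (hR : 0 < R) (hm : 0 ≤ m) :
    ∃ b C : ℝ, 0 < b ∧ 0 ≤ C ∧
    ∀ (v : Eucl n → ℝ) (G : Eucl n → Eucl n), IsSobolevLimit v G →
    ∀ (S U : Set (Eucl n)) (η : ℝ), 0 < η → (energy G).real U ≤ η ^ n →
      (∀ x ∈ S, ContinuousAt v x ∧ |ringMean v x R| ≤ m * η ∧ Metric.closedBall x R ⊆ U) →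
      ∀ K : ℕ, volume {x ∈ S | b * η * (((K : ℝ) + 1) ^ (n - 1)) ^ (1 / (n : ℝ)) < |v x|} ≤
        ENNReal.ofReal (C * (1 / 2) ^ K) := by
  have hn0 : n ≠ 0 := by omega
  have hd := volume_real_unitRing_pos hn
  set d := volume.real (unitRing n) with hd'
  have hC := ringConst_nonneg n
  have hS := geomConst_pos hn0
  set V := volume.real (Metric.ball (0 : Eucl n) 1) with hV
  have hV0 : 0 ≤ V := measureReal_nonneg
  -- The numerator collects the ring average, the first `K` scales (factor 2, from 2η^n ≤ (2η)^n)
  -- and the geometric tail. Using K + 1 in the threshold makes `L` ≥ 1, so that the terms without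
  -- `L` are absorbed.
  refine ⟨(m + ringConst n * (2 + geomConst n) + 1) / d, (5 * R) ^ n * V, by positivity,
    by positivity, ?_⟩
  intro v G h S U η hη hU hSU K
  have := isFiniteMeasure_energy hn0 h.memLp_grad
  set L : ℝ := (((K : ℝ) + 1) ^ (n - 1)) ^ (1 / (n : ℝ)) with hL
  have hL1 : 1 ≤ L := Real.one_le_rpow (one_le_pow₀ (by linarith [(Nat.cast_nonneg K : (0:ℝ) ≤ K)]))
    (by positivity)
  set T := {x ∈ S | (m + ringConst n * (2 + geomConst n) + 1) / d * η * L < |v x|} with hT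
  have hk : ∀ x ∈ T, ∃ k : ℕ, η ^ n * (1 / 2) ^ k <
      (energy G).real (Metric.closedBall x (R * (1 / 2) ^ (K + k))) := by
    intro x hx
    obtain ⟨h1, h2, h3⟩ := hSU x hx.1
    by_contra! hcon
    have h5 := abs_mul_le_of_energy_decay hn0 h h1 hR (θ := η ^ n) (by positivity) (K := K) hcon
    have h6 : (energy G).real (Metric.closedBall x R) ≤ η ^ n := (measureReal_mono h3).trans hU
    have h7 : ((K : ℝ) ^ (n - 1) * (2 * (energy G).real (Metric.closedBall x R))) ^ (1 / (n : ℝ)) ≤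
        L * (2 * η) := by
      calc _ ≤ (((K : ℝ) + 1) ^ (n - 1) * (2 * η) ^ n) ^ (1 / (n : ℝ)) := by
            have h8 : 2 * (energy G).real (Metric.closedBall x R) ≤ (2 * η) ^ n := by
              rw [mul_pow]
              have : (2 : ℝ) ≤ 2 ^ n := by
                calc (2 : ℝ) = 2 ^ 1 := by norm_num
                  _ ≤ 2 ^ n := pow_le_pow_right₀ (by norm_num) (by omega)
              have h9 : (0 : ℝ) ≤ (energy G).real (Metric.closedBall x R) := measureReal_nonneg
              nlinarith
            have h9 : (0 : ℝ) ≤ (energy G).real (Metric.closedBall x R) := measureReal_nonneg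
            gcongr
            linarith
        _ = _ := by
            rw [Real.mul_rpow (by positivity) (by positivity), one_div (n : ℝ),
              Real.pow_rpow_inv_natCast (by positivity : (0 : ℝ) ≤ 2 * η) hn0, hL, one_div (n : ℝ)]
    rw [one_div (n : ℝ), Real.pow_rpow_inv_natCast hη.le hn0, ← one_div (n : ℝ)] at h5
    have h8 := hx.2
    rw [div_mul_eq_mul_div, div_mul_eq_mul_div, div_lt_iff₀ hd] at h8
    have h9 : |v x| * d ≤ m * η + ringConst n * (L * (2 * η) + η * geomConst n) := by
      refine h5.trans ?_
      gcongr
    have h10 : m * η + ringConst n * (L * (2 * η) + η * geomConst n) ≤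
        (m + ringConst n * (2 + geomConst n) + 1) * η * L := by
      have e : (m + ringConst n * (2 + geomConst n) + 1) * η * L -
        (m * η + ringConst n * (L * (2 * η) + η * geomConst n)) =
        (m * η + ringConst n * geomConst n * η) * (L - 1) + η * L := by ring
      have : 0 ≤ (m * η + ringConst n * geomConst n * η) * (L - 1) + η * L :=
        add_nonneg (mul_nonneg (by positivity) (by linarith)) (by positivity)
      linarith
    linarith
  choose! k hk using hk
  have hle1 : ∀ k : ℕ, R * (1 / 2) ^ k ≤ R := fun k =>
    mul_le_of_le_one_right hR.le (pow_le_one₀ (by norm_num) (by norm_num))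
  have hmain := outerMeasure_le_of_ball_le volume.toOuterMeasure (energy G)
    (S := T) (U := U) (ρ := fun x => R * (1 / 2) ^ (K + k x)) (R := R)
    (c := ENNReal.ofReal ((5 * R) ^ n * V * (1 / 2) ^ K / η ^ n)) (fun x _ => by positivity)
    (fun x _ => hle1 _)
    (fun x hx => (Metric.closedBall_subset_closedBall (hle1 _)).trans (hSU x hx.1).2.2) ?_
  · refine hmain.trans ?_
    rw [← ofReal_measureReal (μ := energy G) (s := U), ← ENNReal.ofReal_mul (by positivity)]
    refine ENNReal.ofReal_le_ofReal ?_
    rw [div_mul_eq_mul_div, div_le_iff₀ (by positivity)]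
    gcongr
  · intro x hx
    change volume _ ≤ _
    rw [Measure.addHaar_closedBall _ _ (by positivity), finrank_euclideanSpace_fin,
      ← ofReal_measureReal (μ := energy G), ← ENNReal.ofReal_mul (by positivity),
      ← ofReal_measureReal (μ := volume) (s := Metric.ball (0 : Eucl n) 1)
        measure_ball_lt_top.ne, ← ENNReal.ofReal_mul (by positivity)]
    refine ENNReal.ofReal_le_ofReal ?_
    have h3 := (hk x hx).le
    have h4 : ((1 / 2 : ℝ) ^ (K + k x)) ^ n ≤ (1 / 2) ^ (K + k x) :=
      pow_le_of_le_one (by positivity) (pow_le_one₀ (by norm_num) (by norm_num)) hn0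
    calc (5 * (R * (1 / 2) ^ (K + k x))) ^ n * V
        = (5 * R) ^ n * V * ((1 / 2 : ℝ) ^ (K + k x)) ^ n := by
          rw [← mul_assoc, mul_pow (5 * R)]; ring
      _ ≤ (5 * R) ^ n * V * (1 / 2) ^ (K + k x) := by gcongr
      _ = (5 * R) ^ n * V * (1 / 2) ^ K / η ^ n * (η ^ n * (1 / 2) ^ k x) := by
          rw [pow_add]; field_simp
      _ ≤ _ := by gcongr

end Covering

/-! ### Zero extension, and confinement of connected superlevel sets -/

section ZeroExtension

theorem gradient_eq_zero_of_notMem_tsupport {n : ℕ} {φ : Eucl n → ℝ} {x : Eucl n}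
    (hx : x ∉ tsupport φ) : gradient φ x = 0 := by
  rw [← norm_eq_zero, norm_gradient, norm_eq_zero]
  have h : φ =ᶠ[𝓝 x] fun _ => 0 := notMem_tsupport_iff_eventuallyEq.1 hx
  rw [h.fderiv_eq, fderiv_const_apply]

/-- Test functions and their gradients vanish off Ω, so the approximation holds for the zero
extensions on the whole space, and rings may leave Ω. -/
theorem MemW1n0.isSobolevLimit {n : ℕ} {Ω : Set (Eucl n)} (hΩ : IsOpen Ω) {u : Eucl n → ℝ}
    (hu : MemW1n0 Ω u) : IsSobolevLimit (Ω.indicator u) (Ω.indicator (weakGrad Ω u)) where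
  memLp := (memLp_indicator_iff_restrict hΩ.measurableSet).2 hu.1.2.1
  memLp_grad := (memLp_indicator_iff_restrict hΩ.measurableSet).2 hu.1.2.2
  exists_approx ε hε := by
    obtain ⟨φ, ⟨hφ, hφc, hφΩ⟩, h1, h2⟩ := hu.2 ε hε
    refine ⟨φ, hφ, hφc, ?_, ?_⟩
    · convert h1 using 1
      rw [← eLpNorm_indicator_eq_eLpNorm_restrict hΩ.measurableSet]
      congr 1
      ext x
      by_cases hx : x ∈ Ω
      · simp [hx]
      · have : φ x = 0 := image_eq_zero_of_notMem_tsupport fun h => hx (hφΩ h)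
        simp [hx, this]
    · convert h2 using 1
      rw [← eLpNorm_indicator_eq_eLpNorm_restrict hΩ.measurableSet]
      congr 1
      ext1 x
      by_cases hx : x ∈ Ω
      · simp [hx]
      · have : gradient φ x = 0 := gradient_eq_zero_of_notMem_tsupport fun h => hx (hφΩ h)
        simp [hx, this]

theorem energy_indicator_apply {n : ℕ} (hn : n ≠ 0) {Ω U : Set (Eucl n)} (hΩ : MeasurableSet Ω)
    (hU : MeasurableSet U) (G : Eucl n → Eucl n) :
    energy (Ω.indicator G) U = ∫⁻ x in Ω ∩ U, ‖G x‖ₑ ^ n := by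
  rw [energy, withDensity_apply _ hU, ← setLIntegral_indicator hΩ]
  refine lintegral_congr fun x => ?_
  by_cases hx : x ∈ Ω
  · simp [hx]
  · simp [hx, hn]

theorem continuousAt_indicator_of_mem {n : ℕ} {Ω : Set (Eucl n)} (hΩ : IsOpen Ω) {u : Eucl n → ℝ}
    (hu : ContinuousOn u Ω) {x : Eucl n} (hx : x ∈ Ω) : ContinuousAt (Ω.indicator u) x := by
  refine (hu.continuousAt (hΩ.mem_nhds hx)).congr ?_
  filter_upwards [hΩ.mem_nhds hx] with y hy
  rw [indicator_of_mem hy]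

theorem ringMean_eq_zero {n : ℕ} {v : Eucl n → ℝ} {x : Eucl n} {a : ℝ}
    (h : ∀ y ∈ unitRing n, v (x + a • y) = 0) : ringMean v x a = 0 :=
  setIntegral_eq_zero_of_forall_eq_zero h

/-- An open set with smooth boundary satisfies the exterior cone condition. -/
theorem exists_exterior_balls {n : ℕ} {Ω : Set (Eucl n)} (hΩ : IsOpen Ω)
    (hs : HasSmoothBoundary Ω) {p : Eucl n} (hp : p ∈ frontier Ω) :
    ∃ (e : Eucl n) (c : ℝ), 0 < c ∧ c ≤ 1 ∧ ‖e‖ ≤ 1 ∧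
      ∀ᶠ ρ in 𝓝[>] (0 : ℝ), Metric.ball (p + ρ • e) (c * ρ) ⊆ Ωᶜ := by
  obtain ⟨U, ψ, hU, hpU, hψ, hne, hf, hi⟩ := hs p hp
  set L := fderiv ℝ ψ p with hL
  obtain ⟨e, he1, heL⟩ : ∃ e : Eucl n, ‖e‖ ≤ 1 ∧ 0 < L e := by
    obtain ⟨w, hw⟩ : ∃ w, L w ≠ 0 := by
      by_contra! h
      exact hne (ContinuousLinearMap.ext h)
    have hw0 : w ≠ 0 := by rintro rfl; simp at hw
    have hwn : 0 < ‖w‖ := norm_pos_iff.2 hw0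
    refine ⟨(L w / |L w| * ‖w‖⁻¹) • w, ?_, ?_⟩
    · rw [norm_smul, norm_mul, norm_div, norm_inv, norm_norm, Real.norm_eq_abs, Real.norm_eq_abs,
        abs_abs, div_self (abs_ne_zero.2 hw), one_mul, inv_mul_cancel₀ hwn.ne']
    · rw [map_smul, smul_eq_mul]
      have : L w / |L w| * ‖w‖⁻¹ * L w = |L w| * ‖w‖⁻¹ := by
        have h1 := abs_mul_abs_self (L w)
        have h2 := abs_ne_zero.2 hw
        field_simp
        nlinarith
      rw [this]
      positivity
  have hψp : ψ p = 0 := by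
    have : p ∈ frontier Ω ∩ U := ⟨hp, hpU⟩
    rw [hf] at this
    exact this.2
  have hd : HasFDerivAt ψ L p :=
    ((hψ.contDiffAt (hU.mem_nhds hpU)).differentiableAt (by simp)).hasFDerivAt
  have hLn : 0 ≤ ‖L‖ := norm_nonneg _
  have hev := (hd.isLittleO.def (c := L e / 4) (by positivity)).and (hU.mem_nhds hpU)
  obtain ⟨δ, hδ, hball⟩ := Metric.mem_nhds_iff.1 hev
  -- With this `c`, a point at distance less than cρ from p + ρe has ψ at least ρ·Le(1 - 1/4 - 1/2)
  -- > 0: the quarter bounds the linear term of the deviation, the half the Taylor remainder.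
  set c := min 1 (L e / (4 * (‖L‖ + 1))) with hc
  have hc0 : 0 < c := lt_min one_pos (by positivity)
  have hc1 : c ≤ 1 := min_le_left _ _
  have hcL : ‖L‖ * c ≤ L e / 4 := by
    have h1 : c * (4 * (‖L‖ + 1)) ≤ L e := (le_div_iff₀ (by positivity)).1 (min_le_right _ _)
    nlinarith
  refine ⟨e, c, hc0, hc1, he1, ?_⟩
  filter_upwards [self_mem_nhdsWithin,
    mem_nhdsWithin_of_mem_nhds (Iio_mem_nhds (half_pos hδ))] with ρ hρ hρδ y hy hyΩ
  have hρ0 : 0 < ρ := hρ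
  have hρδ' : ρ < δ / 2 := hρδ
  rw [Metric.mem_ball, dist_eq_norm] at hy
  set z := y - (p + ρ • e) with hz
  have hyp : y - p = ρ • e + z := by rw [hz]; abel
  have hnorm : ‖y - p‖ ≤ 2 * ρ := by
    rw [hyp]
    refine (norm_add_le _ _).trans ?_
    rw [norm_smul, Real.norm_eq_abs, abs_of_pos hρ0]
    nlinarith
  have hyb : y ∈ Metric.ball p δ := by
    rw [Metric.mem_ball, dist_eq_norm]
    linarith
  obtain ⟨h1, hyU⟩ := hball hyb
  have h2 : ‖ψ y - ψ p - L (y - p)‖ ≤ L e / 4 * ‖y - p‖ := h1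
  rw [hψp, sub_zero, Real.norm_eq_abs, hyp, map_add, map_smul, smul_eq_mul, ← hyp] at h2
  have h3 : |L z| ≤ ‖L‖ * (c * ρ) := (L.le_opNorm z).trans (by gcongr)
  have h4 : ψ y < 0 := by
    have : y ∈ interior Ω ∩ U := ⟨by rwa [hΩ.interior_eq], hyU⟩
    rw [hi] at this
    exact this.2
  have h5 := (abs_le.1 h2).1
  have h6 := (abs_le.1 h3).1
  nlinarith

theorem exists_dist_eq_of_isPreconnected {n : ℕ} {A : Set (Eucl n)} (hA : IsPreconnected A)
    {p x y : Eucl n} (hx : x ∈ A) (hy : y ∈ A) {s : ℝ} (h1 : dist x p ≤ s) (h2 : s ≤ dist y p) :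
    ∃ z ∈ A, dist z p = s :=
  hA.intermediate_value hx hy (continuous_id.dist continuous_const).continuousOn ⟨h1, h2⟩

theorem tendsto_energy_closedBall {n : ℕ} (hn : 2 ≤ n) {G : Eucl n → Eucl n}
    (hG : MemLp G n volume) (p : Eucl n) :
    Tendsto (fun ρ => (energy G).real (Metric.closedBall p ρ)) (𝓝[>] 0) (𝓝 0) := by
  have := isFiniteMeasure_energy (by omega) hG
  have := nontrivial_eucl hn
  have h1 : energy G {p} = 0 :=
    withDensity_absolutelyContinuous _ _ (measure_singleton p)
  have h2 := tendsto_measure_cthickening (μ := energy G) (s := {p})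
    ⟨1, one_pos, (measure_lt_top _ _).ne⟩
  rw [closure_singleton, h1] at h2
  have h3 := (ENNReal.tendsto_toReal ENNReal.zero_ne_top).comp
    (h2.mono_left (nhdsWithin_le_nhds (s := Ioi 0)))
  refine (h3.congr' ?_)
  filter_upwards [self_mem_nhdsWithin] with ρ hρ
  simp only [Function.comp]
  rw [Metric.cthickening_singleton p (le_of_lt hρ), measureReal_def]

/-- If `A` accumulated at p ∈ ∂Ω it would cross every shell ρ < |x - p| < 2ρ with ρ small. Near `p`
ring averages are small, since a ring of size cρ outside Ω is within reach; so the crossing would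
need a fixed energy in B_{3ρ}(p), which tends to 0 with ρ. -/
theorem closure_subset_of_isPreconnected {n : ℕ} (hn : 2 ≤ n) {Ω : Set (Eucl n)} (hΩ : IsOpen Ω)
    (hs : HasSmoothBoundary Ω) {u : Eucl n → ℝ} (hu : MemW1n0 Ω u) (huc : ContinuousOn u Ω)
    {A : Set (Eucl n)} (hA : IsPreconnected A) (hAΩ : A ⊆ Ω) (hA1 : ∀ x ∈ A, 1 ≤ u x) :
    closure A ⊆ Ω := by
  intro p hp
  by_contra hpΩ
  have hn0 : n ≠ 0 := by omega
  have h := hu.isSobolevLimit hΩ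
  set v := Ω.indicator u with hv
  set G := Ω.indicator (weakGrad Ω u) with hG
  have := isFiniteMeasure_energy hn0 h.memLp_grad
  have hpf : p ∈ frontier Ω := by
    rw [hΩ.frontier_eq]
    exact ⟨closure_mono hAΩ hp, hpΩ⟩
  obtain ⟨e, c, hc0, hc1, he, hext⟩ := exists_exterior_balls hΩ hs hpf
  obtain ⟨x₁, hx₁⟩ : A.Nonempty := closure_nonempty_iff.1 ⟨p, hp⟩
  have hδ : 0 < dist x₁ p := dist_pos.2 fun hxp => hpΩ (hxp ▸ hAΩ hx₁)
  obtain ⟨κ, hκ, hcross⟩ := exists_crossing_const hn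
  have hd := volume_real_unitRing_pos hn
  set d := volume.real (unitRing n)
  have hlim : Tendsto (fun ρ => (energy G).real (Metric.closedBall p (3 * ρ))) (𝓝[>] 0) (𝓝 0) := by
    refine (tendsto_energy_closedBall hn h.memLp_grad p).comp ?_
    refine tendsto_nhdsWithin_iff.2 ⟨?_, ?_⟩
    · have : Tendsto (fun ρ : ℝ => 3 * ρ) (𝓝 0) (𝓝 (3 * 0)) := tendsto_id.const_mul 3
      rw [mul_zero] at this
      exact this.mono_left nhdsWithin_le_nhds
    · filter_upwards [self_mem_nhdsWithin] with ρ hρ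
      have : 0 < ρ := hρ
      exact mul_pos three_pos this
  -- From the ring (x, ρ) to the exterior ring (p + ρe, cρ), the centre moves by at most 3ρ and the
  -- radius by at most ρ; relative to the smaller radius cρ this is 4/c.
  have hlim2 : Tendsto (fun ρ => ringConst n * (4 / c) *
      (energy G).real (Metric.closedBall p (3 * ρ)) ^ (1 / (n : ℝ))) (𝓝[>] 0) (𝓝 0) := by
    have := (hlim.rpow_const (p := 1 / (n : ℝ)) (Or.inr (by positivity))).const_mul
      (ringConst n * (4 / c))
    rwa [Real.zero_rpow (by positivity), mul_zero] at this
  obtain ⟨ρ, hρ, hρδ, hρe, hρ1, hρ2⟩ := ((eventually_mem_nhdsWithin (a := (0 : ℝ)) (s := Ioi 0)).and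
    ((eventually_nhdsWithin_of_eventually_nhds (eventually_lt_nhds (half_pos hδ))).and
    (hext.and ((hlim.eventually_lt_const (inv_pos.2 hκ)).and
      (hlim2.eventually_lt_const (by positivity : 0 < d / 4)))))).exists
  have hρ0 : 0 < ρ := hρ
  have hρδ' : ρ < dist x₁ p / 2 := hρδ
  -- Shell start, shell width and averaging scale are all ρ, so ρ cancels from the crossing
  -- inequality.
  have hfin := hcross v G h A (Metric.closedBall p (3 * ρ)) p ρ ρ ρ hρ0 ?_ ?_
  · have h1 : 1 ≤ κ * (energy G).real (Metric.closedBall p (3 * ρ)) := by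
      have : ρ * 1 ≤ ρ * (κ * (energy G).real (Metric.closedBall p (3 * ρ))) := by linarith
      exact le_of_mul_le_mul_left this hρ0
    have h2 := mul_lt_mul_of_pos_left hρ1 hκ
    rw [mul_inv_cancel₀ hκ.ne'] at h2
    linarith
  · intro s hs
    obtain ⟨y, hy, hyA⟩ := mem_closure_iff_nhds.1 hp _ (Metric.ball_mem_nhds p hρ0)
    exact exists_dist_eq_of_isPreconnected hA hyA hx₁ ((Metric.mem_ball.1 hy).le.trans hs.1.le)
      (by linarith [hs.2])
  · intro x hxA hx
    refine ⟨continuousAt_indicator_of_mem hΩ huc (hAΩ hxA), ?_, ?_, ?_⟩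
    · rw [hv, indicator_of_mem (hAΩ hxA)]
      exact hA1 x hxA
    · have h0 : ringMean v (p + ρ • e) (c * ρ) = 0 := by
        refine ringMean_eq_zero fun y hy => ?_
        refine indicator_of_notMem (hρe ?_) u
        rw [Metric.mem_ball, dist_eq_norm, add_sub_cancel_left, norm_smul, Real.norm_eq_abs,
          abs_of_pos (by positivity)]
        have := (mem_unitRing.1 hy).2
        have h2 : 0 < c * ρ := by positivity
        nlinarith
      have hxp : ‖x - p‖ ≤ 2 * ρ := by
        rw [← dist_eq_norm]
        linarith [hx.2]
      have hq : ‖ρ • e‖ ≤ ρ := by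
        rw [norm_smul, Real.norm_eq_abs, abs_of_pos hρ0]
        nlinarith
      have hcρ : c * ρ ≤ ρ := by nlinarith
      have h1 := abs_ringMean_sub_le_energy hn0 h (x := x) (x' := p + ρ • e) (a := ρ)
        (a' := c * ρ) (b := c * ρ) (by positivity) hcρ le_rfl (U := Metric.closedBall p (3 * ρ))
        Metric.isClosed_closedBall.measurableSet ?_
      · rw [h0, zero_sub, abs_neg] at h1
        refine h1.trans (le_trans ?_ hρ2.le)
        have hC := ringConst_nonneg n
        have hfrac : (‖p + ρ • e - x‖ + |c * ρ - ρ|) / (c * ρ) ≤ 4 / c := ?_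
        · exact mul_le_mul_of_nonneg_right (mul_le_mul_of_nonneg_left hfrac hC)
            (Real.rpow_nonneg measureReal_nonneg _)
        rw [div_le_div_iff₀ (by positivity) hc0, abs_of_nonpos (by linarith)]
        have h3 : ‖p + ρ • e - x‖ ≤ 3 * ρ := by
          have : p + ρ • e - x = ρ • e - (x - p) := by abel
          rw [this]
          exact (norm_sub_le _ _).trans (by linarith)
        have h4 : ‖p + ρ • e - x‖ + -(c * ρ - ρ) ≤ 4 * ρ := by
          have : 0 < c * ρ := by positivity
          linarith
        nlinarith
      · intro t ht y hy
        rw [Metric.mem_closedBall, dist_eq_norm]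
        have e1 : x + t • (p + ρ • e - x) + (ρ + t * (c * ρ - ρ)) • y - p =
            (1 - t) • (x - p) + t • (ρ • e) + (ρ + t * (c * ρ - ρ)) • y := by module
        rw [e1]
        have hy1 := (mem_unitRing.1 hy).2
        have e2 : ‖(1 - t) • (x - p)‖ ≤ (1 - t) * (2 * ρ) := by
          rw [norm_smul, Real.norm_eq_abs, abs_of_nonneg (by linarith [ht.2])]
          exact mul_le_mul_of_nonneg_left hxp (by linarith [ht.2])
        have e3 : ‖t • (ρ • e)‖ ≤ t * ρ := by
          rw [norm_smul, Real.norm_eq_abs, abs_of_nonneg ht.1]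
          exact mul_le_mul_of_nonneg_left hq ht.1
        have e4 : 0 ≤ ρ + t * (c * ρ - ρ) := by
          have : 0 < c * ρ := by positivity
          nlinarith [ht.1, ht.2]
        have e5 : ‖(ρ + t * (c * ρ - ρ)) • y‖ ≤ ρ := by
          rw [norm_smul, Real.norm_eq_abs, abs_of_nonneg e4]
          have : ρ + t * (c * ρ - ρ) ≤ ρ := by nlinarith [ht.1, ht.2]
          nlinarith [norm_nonneg y]
        refine (norm_add₃_le).trans ?_
        nlinarith [ht.1]
    · refine Metric.closedBall_subset_closedBall' ?_
      linarith [hx.2]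

/-- Far from the origin the ring means are controlled by the energy, for functions that vanish
outside a ball. -/
theorem abs_ringMean_le_of_eq_zero {n : ℕ} (hn : n ≠ 0) {v : Eucl n → ℝ} {G : Eucl n → Eucl n}
    (h : IsSobolevLimit v G) {M r : ℝ} (hM : 0 < M) (hr : 0 < r)
    (hv : ∀ x, M ≤ ‖x‖ → v x = 0) {x : Eucl n} (hx : r ≤ ‖x‖) :
    |ringMean v x (r / 2)| ≤ ringConst n * ((M + r / 2) / (r / 2)) *
      (energy G).real (Metric.ball 0 (r / 2))ᶜ ^ (1 / (n : ℝ)) := by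
  have hx0 : 0 < ‖x‖ := hr.trans_le hx
  -- A radial translation outwards by M + r/2: it carries the ring into the region where v vanishes,
  -- and every intermediate ring stays outside B_{r/2}(0).
  set w : Eucl n := ((M + r / 2) / ‖x‖) • x with hw
  have hwn : ‖w‖ = M + r / 2 := by
    rw [hw, norm_smul, Real.norm_eq_abs, abs_of_pos (by positivity)]
    field_simp
  have hsum : ∀ t : ℝ, 0 ≤ t → ‖x + t • w‖ = ‖x‖ + t * (M + r / 2) := by
    intro t ht
    have : x + t • w = (1 + t * ((M + r / 2) / ‖x‖)) • x := by
      rw [hw, add_smul, one_smul, smul_smul]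
    rw [this, norm_smul, Real.norm_eq_abs, abs_of_pos (by positivity)]
    field_simp
  have hlow : ∀ t : ℝ, 0 ≤ t → ∀ y ∈ unitRing n,
      ‖x‖ + t * (M + r / 2) - r / 2 ≤ ‖x + t • w + (r / 2) • y‖ := by
    intro t ht y hy
    have h1 := norm_sub_le_norm_add (x + t • w) ((r / 2) • y)
    rw [hsum t ht, norm_smul, Real.norm_eq_abs, abs_of_pos (by positivity)] at h1
    have := (mem_unitRing.1 hy).2
    nlinarith
  have h0 : ringMean v (x + w) (r / 2) = 0 := by
    refine ringMean_eq_zero fun y hy => hv _ ?_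
    have := hlow 1 zero_le_one y hy
    rw [one_smul] at this
    linarith
  have h1 := abs_ringMean_sub_le_energy hn h (x := x) (x' := x + w) (a := r / 2)
    (a' := r / 2) (b := r / 2) (by positivity) le_rfl le_rfl (U := (Metric.ball 0 (r / 2))ᶜ)
    Metric.isOpen_ball.measurableSet.compl ?_
  · rwa [h0, zero_sub, abs_neg, sub_self, abs_zero, add_zero, add_sub_cancel_left, hwn] at h1
  · intro t ht y hy
    rw [sub_self, mul_zero, add_zero, add_sub_cancel_left, mem_compl_iff, mem_ball_zero_iff, not_lt]
    have := hlow t ht.1 y hy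
    have h2 : 0 ≤ t * (M + r / 2) := mul_nonneg ht.1 (by positivity)
    linarith

theorem closedBall_subset_compl_ball {n : ℕ} {r : ℝ} {x : Eucl n} (hx : r ≤ ‖x‖) :
    Metric.closedBall x (r / 2) ⊆ (Metric.ball 0 (r / 2))ᶜ := by
  intro y hy
  rw [Metric.mem_closedBall, dist_eq_norm] at hy
  rw [mem_compl_iff, mem_ball_zero_iff, not_lt]
  have := norm_sub_norm_le x y
  rw [norm_sub_rev] at this
  linarith

/-- A connected set that meets B_r(0) and leaves B_{2r}(0) crosses the shell r < |x| < 2r, which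
costs a fixed energy outside B_{r/2}(0). -/
theorem exists_energy_bound_subset_ball {n : ℕ} (hn : 2 ≤ n) {M r : ℝ} (hM : 0 < M) (hr : 0 < r) :
    ∃ κ : ℝ, 0 < κ ∧ ∀ (v : Eucl n → ℝ) (G : Eucl n → Eucl n), IsSobolevLimit v G →
      (∀ x, M ≤ ‖x‖ → v x = 0) → (energy G).real (Metric.ball 0 (r / 2))ᶜ < κ →
      ∀ A : Set (Eucl n), IsPreconnected A → (∀ x ∈ A, ContinuousAt v x ∧ 1 ≤ v x) →
        (A ∩ Metric.ball 0 r).Nonempty → A ⊆ Metric.ball 0 (2 * r) := by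
  have hn0 : n ≠ 0 := by omega
  obtain ⟨c, hc, hcross⟩ := exists_crossing_const hn
  have hd := volume_real_unitRing_pos hn
  have hC := ringConst_nonneg n
  set d := volume.real (unitRing n)
  set m := ringConst n * ((M + r / 2) / (r / 2)) with hm
  have hm0 : 0 ≤ m := by positivity
  -- The first bound contradicts the crossing inequality with width r and scale r/2; the second
  -- makes the ring averages at most d/4.
  refine ⟨min (1 / c) ((d / (4 * (m + 1))) ^ n), by positivity, ?_⟩
  intro v G h hv hκ A hA hA1 hAr x₂ hx₂
  by_contra hx₂r
  rw [mem_ball_zero_iff, not_lt] at hx₂r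
  obtain ⟨x₁, hx₁, hx₁r⟩ := hAr
  rw [mem_ball_zero_iff] at hx₁r
  set E := (energy G).real (Metric.ball 0 (r / 2))ᶜ with hE
  have hE0 : 0 ≤ E := measureReal_nonneg
  have hfin := hcross v G h A (Metric.ball 0 (r / 2))ᶜ 0 r r (r / 2) (by positivity) ?_ ?_
  · have h1 : E < 1 / c := hκ.trans_le (min_le_left _ _)
    rw [lt_div_iff₀ hc] at h1
    nlinarith
  · intro s hs
    refine exists_dist_eq_of_isPreconnected hA hx₁ hx₂ ?_ ?_
    · rw [dist_zero_right]; linarith [hs.1]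
    · rw [dist_zero_right]; linarith [hs.2]
  · intro x hx hxs
    rw [dist_zero_right] at hxs
    refine ⟨(hA1 x hx).1, (hA1 x hx).2, ?_, closedBall_subset_compl_ball hxs.1.le⟩
    refine (abs_ringMean_le_of_eq_zero hn0 h hM hr hv hxs.1.le).trans ?_
    have h1 : E ^ (1 / (n : ℝ)) ≤ d / (4 * (m + 1)) := by
      have h2 := Real.rpow_le_rpow hE0 (hκ.le.trans (min_le_right _ _)) (z := 1 / (n : ℝ))
        (by positivity)
      rwa [one_div (n : ℝ), Real.pow_rpow_inv_natCast (by positivity) hn0, ← one_div (n : ℝ)] at h2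
    calc m * E ^ (1 / (n : ℝ)) ≤ m * (d / (4 * (m + 1))) := by gcongr
      _ ≤ d / 4 := by
        rw [mul_div_assoc', div_le_div_iff₀ (by positivity) (by positivity)]
        nlinarith

end ZeroExtension

/-! ### Exponential integrability away from the origin, and vanishing of the functional -/

section ExponentialIntegrability

/-- Convexity of exp between 0 and cs. The factor `l` is what makes the exponential integral small,
and not only bounded. -/
theorem exp_mul_sub_one_le {l c s : ℝ} (hl : 0 ≤ l) (hl1 : l ≤ 1) :
    Real.exp (l * c * s) - 1 ≤ l * Real.exp (c * s) := by
  have := convexOn_exp.2 (mem_univ (0 : ℝ)) (mem_univ (c * s)) (sub_nonneg.2 hl1) hl (by ring)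
  simp only [smul_eq_mul, mul_zero, zero_add, Real.exp_zero, mul_one] at this
  rw [mul_assoc]
  linarith

/-- No sharp constant is needed: small energy scales the thresholds of the level sets down, so any α
becomes subcritical. The integrand grows like (3/2)^K on level sets of measure at most C/2^K, and
the convexity factor `l` makes the convergent sum small. -/
theorem exists_lintegral_exp_bound {n : ℕ} (hn : 2 ≤ n) {M r α δ : ℝ} (hM : 0 < M) (hr : 0 < r)
    (hα : 0 < α) (hδ : 0 < δ) :
    ∃ κ : ℝ, 0 < κ ∧ ∀ (v : Eucl n → ℝ) (G : Eucl n → Eucl n), IsSobolevLimit v G →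
      (∀ x, M ≤ ‖x‖ → v x = 0) → (energy G).real (Metric.ball 0 (r / 2))ᶜ < κ →
      ∀ S : Set (Eucl n), MeasurableSet S → S ⊆ Metric.ball 0 M →
        (∀ x ∈ S, ContinuousAt v x ∧ r ≤ ‖x‖) →
        ∫⁻ x in S, ENNReal.ofReal (Real.exp (α * |v x| ^ ((n : ℝ) / ((n : ℝ) - 1))) - 1) ≤
          ENNReal.ofReal δ := by
  have hn0 : n ≠ 0 := by omega
  have hn1 : (0 : ℝ) < (n : ℝ) - 1 := by
    have : (2 : ℝ) ≤ n := by exact_mod_cast hn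
    linarith
  have hnR : (0 : ℝ) < n := by linarith
  have hC := ringConst_nonneg n
  set p : ℝ := (n : ℝ) / ((n : ℝ) - 1) with hp
  have hp0 : 0 < p := by positivity
  set m := ringConst n * ((M + r / 2) / (r / 2)) with hm
  have hm0 : 0 ≤ m := by positivity
  obtain ⟨b, C, hb, hC0, hlevel⟩ := volume_superlevel_le hn (R := r / 2) (by positivity) hm0
  set V := volume.real (Metric.ball (0 : Eucl n) M) with hV
  have hV0 : 0 ≤ V := measureReal_nonneg
  -- 3/2 bounds the integrand below the first level; the levels contribute (9/4)C Σ (3/4)^K = 9C.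
  set Q := 3 / 2 * V + 9 * C with hQ
  have hQ0 : 0 ≤ Q := by positivity
  set c := Real.log (3 / 2) with hc
  have hc0 : 0 < c := Real.log_pos (by norm_num)
  set l := min 1 (δ / (Q + 1)) with hl
  have hl0 : 0 < l := by positivity
  have hlQ : l * Q ≤ δ := by
    have h1 : l ≤ δ / (Q + 1) := min_le_right _ _
    rw [le_div_iff₀ (by positivity)] at h1
    nlinarith
  -- With (bη)^p = τ one has α|v|^p = l c y for y = (|v|/(bη))^p, and since p = n/(n-1) the K-th
  -- level set is exactly {y > K + 1}.
  set τ := l * c / α with hτ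
  have hτ0 : 0 < τ := by positivity
  set η := τ ^ p⁻¹ / b with hη
  have hη0 : 0 < η := by positivity
  have hbη : (b * η) ^ p = τ := by
    rw [hη, mul_div_cancel₀ _ hb.ne', Real.rpow_inv_rpow hτ0.le hp0.ne']
  have hexp : ∀ K : ℕ, Real.exp (c * K) = (3 / 2) ^ K := by
    intro K
    rw [hc, mul_comm, Real.exp_nat_mul, Real.exp_log (by norm_num)]
  refine ⟨η ^ n, by positivity, ?_⟩
  intro v G h hv hE S hS hSM hSv
  set T : ℕ → Set (Eucl n) :=
    fun K => {x ∈ S | b * η * (((K : ℝ) + 1) ^ (n - 1)) ^ (1 / (n : ℝ)) < |v x|} with hT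
  have hTvol : ∀ K, volume (T K) ≤ ENNReal.ofReal (C * (1 / 2) ^ K) := by
    refine hlevel v G h S (Metric.ball 0 (r / 2))ᶜ η hη0 hE.le fun x hx => ?_
    refine ⟨(hSv x hx).1, ?_, closedBall_subset_compl_ball (hSv x hx).2⟩
    refine (abs_ringMean_le_of_eq_zero hn0 h hM hr hv (hSv x hx).2).trans ?_
    refine mul_le_mul_of_nonneg_left ?_ hm0
    have h2 := Real.rpow_le_rpow measureReal_nonneg hE.le (z := 1 / (n : ℝ)) (by positivity)
    rwa [one_div (n : ℝ), Real.pow_rpow_inv_natCast hη0.le hn0, ← one_div (n : ℝ)] at h2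
  -- Measurable hulls have the same measure and dispense with proving the level sets measurable.
  set T' : ℕ → Set (Eucl n) := fun K => toMeasurable volume (T K) with hT'
  have hT'm : ∀ K, MeasurableSet (T' K) := fun K => measurableSet_toMeasurable _ _
  set g : ℕ → Eucl n → ℝ≥0∞ :=
    fun K => (T' K).indicator fun _ => ENNReal.ofReal ((3 / 2) ^ (K + 2)) with hg
  have hpt : ∀ x ∈ S, ENNReal.ofReal (Real.exp (α * |v x| ^ p) - 1) ≤
      ENNReal.ofReal l * (ENNReal.ofReal (3 / 2) + ∑' K, g K x) := by
    intro x hx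
    set y := (|v x| / (b * η)) ^ p with hy
    have hyv : α * |v x| ^ p = l * c * y := by
      rw [hy, Real.div_rpow (abs_nonneg _) (by positivity), hbη, hτ]
      field_simp
    have hex : ∃ K : ℕ, y ≤ (K : ℝ) + 1 := by
      obtain ⟨K, hK⟩ := exists_nat_ge y
      exact ⟨K, by linarith⟩
    have hub : ∀ K : ℕ, y ≤ K → ENNReal.ofReal (Real.exp (α * |v x| ^ p) - 1) ≤
        ENNReal.ofReal l * ENNReal.ofReal ((3 / 2) ^ K) := by
      intro K hK
      rw [hyv, ← ENNReal.ofReal_mul hl0.le, ← hexp]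
      refine ENNReal.ofReal_le_ofReal ((exp_mul_sub_one_le hl0.le (min_le_left _ _)).trans ?_)
      gcongr
    classical
    have hs := Nat.find_spec hex
    have hmin := fun K hK => Nat.find_min hex (m := K) hK
    -- Either y ≤ 1, or K + 1 < y ≤ K + 2 for some `K`; then x is in `T K`, which explains the power
    -- K + 2 in `g`.
    rcases hK : Nat.find hex with _ | K
    · rw [hK] at hs
      refine (hub 1 (by simpa using hs)).trans ?_
      rw [pow_one]
      gcongr
      exact le_self_add
    · rw [hK] at hs hmin
      have h1 := hmin K (Nat.lt_succ_self K)
      rw [not_le] at h1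
      have hxT : x ∈ T K := by
        refine ⟨hx, ?_⟩
        rw [← lt_div_iff₀' (by positivity)]
        have h2 := Real.rpow_lt_rpow (by positivity) h1 (inv_pos.2 hp0)
        rw [hy, Real.rpow_rpow_inv (by positivity) hp0.ne'] at h2
        refine lt_of_eq_of_lt ?_ h2
        rw [← Real.rpow_natCast, ← Real.rpow_mul (by positivity), hp, Nat.cast_sub (by omega)]
        congr 1
        push_cast
        field_simp
      refine (hub (K + 2) ?_).trans ?_
      · push_cast at hs ⊢
        linarith
      · gcongr
        refine le_trans ?_ (le_add_self)
        refine le_trans (le_of_eq ?_) (ENNReal.le_tsum K)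
        rw [hg]
        simp only
        rw [indicator_of_mem (subset_toMeasurable _ _ hxT)]
  calc ∫⁻ x in S, ENNReal.ofReal (Real.exp (α * |v x| ^ p) - 1)
      ≤ ∫⁻ x in S, ENNReal.ofReal l * (ENNReal.ofReal (3 / 2) + ∑' K, g K x) :=
        setLIntegral_mono' hS hpt
    _ = ENNReal.ofReal l * (ENNReal.ofReal (3 / 2) * volume S + ∑' K, ∫⁻ x in S, g K x) := by
        rw [lintegral_const_mul' _ _ ENNReal.ofReal_ne_top, lintegral_add_left measurable_const,
          setLIntegral_const, lintegral_tsum]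
        exact fun K => (measurable_const.indicator (hT'm K)).aemeasurable
    _ ≤ ENNReal.ofReal l * (ENNReal.ofReal (3 / 2) * ENNReal.ofReal V +
          ∑' K : ℕ, ENNReal.ofReal (9 / 4 * C * (3 / 4) ^ K)) := by
        gcongr with K
        · rw [hV, ofReal_measureReal measure_ball_lt_top.ne]
          exact measure_mono hSM
        · refine (setLIntegral_le_lintegral _ _).trans ?_
          rw [hg]
          simp only
          rw [lintegral_indicator_const (hT'm K), measure_toMeasurable]
          refine (mul_le_mul_right (hTvol K) _).trans (le_of_eq ?_)
          rw [← ENNReal.ofReal_mul (by positivity)]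
          congr 1
          have : (3 / 4 : ℝ) ^ K = (3 / 2) ^ K * (1 / 2) ^ K := by rw [← mul_pow]; norm_num
          rw [this, pow_add]
          ring
    _ = ENNReal.ofReal (l * Q) := by
        have hsum : HasSum (fun K : ℕ => 9 / 4 * C * (3 / 4 : ℝ) ^ K) (9 * C) := by
          have := (hasSum_geometric_of_lt_one (r := (3 / 4 : ℝ)) (by norm_num)
            (by norm_num)).mul_left (9 / 4 * C)
          have e : 9 * C = 9 / 4 * C * (1 - 3 / 4 : ℝ)⁻¹ := by ring
          rwa [e]
        rw [← ENNReal.ofReal_tsum_of_nonneg (fun K => by positivity) hsum.summable, hsum.tsum_eq,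
          ← ENNReal.ofReal_mul (by positivity), ← ENNReal.ofReal_add (by positivity) (by positivity),
          ← ENNReal.ofReal_mul hl0.le]
    _ ≤ ENNReal.ofReal δ := ENNReal.ofReal_le_ofReal hlQ

theorem integrableOn_ball_norm_rpow {n : ℕ} (hn : 2 ≤ n) {β : ℝ} (hβ : β < n) :
    IntegrableOn (fun x : Eucl n => 1 / ‖x‖ ^ β) (Metric.ball 0 1) := by
  have := nontrivial_eucl hn
  rw [integrableOn_fun_norm_addHaar volume (f := fun t : ℝ => 1 / t ^ β),
    finrank_euclideanSpace_fin]
  have h1 : IntegrableOn (fun t : ℝ => t ^ ((n : ℝ) - 1 - β)) (Ioo 0 1) :=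
    (intervalIntegral.integrableOn_Ioo_rpow_iff zero_lt_one).2 (by linarith)
  refine h1.congr_fun (fun t ht => ?_) measurableSet_Ioo
  have ht0 : 0 < t := ht.1
  simp only [smul_eq_mul]
  rw [Real.rpow_sub ht0, ← Real.rpow_natCast, Nat.cast_sub (by omega), Nat.cast_one]
  ring

theorem tendsto_lintegral_ball_norm_rpow {n : ℕ} (hn : 2 ≤ n) {β : ℝ} (hβ : β < n) :
    Tendsto (fun ε : ℝ => ∫⁻ x in Metric.ball (0 : Eucl n) ε, ENNReal.ofReal (1 / ‖x‖ ^ β))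
      (𝓝[>] 0) (𝓝 0) := by
  have hint : ∫⁻ x in Metric.ball (0 : Eucl n) 1, ENNReal.ofReal (1 / ‖x‖ ^ β) ≠ ⊤ := by
    have := (integrableOn_ball_norm_rpow hn hβ).2
    rw [hasFiniteIntegral_iff_ofReal (Eventually.of_forall fun x => by positivity)] at this
    exact this.ne
  have hn0 : n ≠ 0 := by omega
  have := nontrivial_eucl hn
  have hvol : Tendsto (fun ε : ℝ => volume (Metric.ball (0 : Eucl n) ε)) (𝓝[>] 0) (𝓝 0) := by
    have h1 : Tendsto (fun ε : ℝ => ENNReal.ofReal (ε ^ n) * volume (Metric.ball (0 : Eucl n) 1))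
        (𝓝 0) (𝓝 (ENNReal.ofReal (0 ^ n) * volume (Metric.ball (0 : Eucl n) 1))) :=
      ENNReal.Tendsto.mul_const (ENNReal.tendsto_ofReal (tendsto_id.pow n))
        (Or.inr measure_ball_lt_top.ne)
    rw [zero_pow hn0, ENNReal.ofReal_zero, zero_mul] at h1
    refine (h1.mono_left nhdsWithin_le_nhds).congr' ?_
    filter_upwards [self_mem_nhdsWithin] with ε hε
    rw [Measure.addHaar_ball _ _ (le_of_lt hε), finrank_euclideanSpace_fin]
  have hvol' : Tendsto ((volume.restrict (Metric.ball (0 : Eucl n) 1)) ∘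
      fun ε : ℝ => Metric.ball (0 : Eucl n) ε) (𝓝[>] 0) (𝓝 0) :=
    tendsto_of_tendsto_of_tendsto_of_le_of_le tendsto_const_nhds hvol (fun _ => zero_le)
      fun ε => Measure.restrict_apply_le _ _
  refine (tendsto_setLIntegral_zero hint hvol').congr' ?_
  filter_upwards [eventually_nhdsWithin_of_eventually_nhds (eventually_lt_nhds one_pos)] with ε hε
  rw [Measure.restrict_restrict Metric.isOpen_ball.measurableSet,
    inter_eq_left.2 (Metric.ball_subset_ball hε.le)]

theorem ConcentratesAt.tendsto_energy {n : ℕ} (hn : n ≠ 0) {Ω : Set (Eucl n)} (hΩ : IsOpen Ω)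
    {u : ℕ → Eucl n → ℝ} (hu : ConcentratesAt Ω u 0) {ε : ℝ} (hε : 0 < ε) :
    Tendsto (fun j => (energy (Ω.indicator (weakGrad Ω (u j)))).real (Metric.ball 0 ε)ᶜ)
      atTop (𝓝 0) := by
  have h1 := (ENNReal.tendsto_toReal ENNReal.zero_ne_top).comp (hu.2 ε hε)
  refine h1.congr fun j => ?_
  rw [measureReal_def, energy_indicator_apply hn hΩ.measurableSet
    Metric.isOpen_ball.measurableSet.compl]
  rfl

/-- Split at B_ε(0). Inside, the bounded numerator meets an integrable weight, which is small for
small ε; outside, the weight is at most ε^{-β} and the vanishing energy makes the exponential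
integral small. -/
theorem tendsto_F_zero_of_bounded {n : ℕ} (hn : 2 ≤ n) {Ω : Set (Eucl n)} (hΩ : IsOpen Ω)
    (hΩb : Bornology.IsBounded Ω) {α β : ℝ} (hα : 0 < α) (hβ : 0 ≤ β) (hβn : β < n)
    {u : ℕ → Eucl n → ℝ} (hu : ∀ j, MemW1n0 Ω (u j)) (huc : ∀ j, ContinuousOn (u j) Ω)
    (hconc : ConcentratesAt Ω u 0) {r B : ℝ} (hr : 0 < r)
    (hB : ∀ᶠ j in atTop, ∀ x ∈ Ω ∩ Metric.ball 0 r, |u j x| ≤ B) :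
    Tendsto (fun j => F α β Ω (u j)) atTop (𝓝 0) := by
  have hn0 : n ≠ 0 := by omega
  have hn1 : (0 : ℝ) < (n : ℝ) - 1 := by
    have : (2 : ℝ) ≤ n := by exact_mod_cast hn
    linarith
  have hnR : (0 : ℝ) < n := by linarith
  have hp0 : 0 < (n : ℝ) / ((n : ℝ) - 1) := by positivity
  obtain ⟨M, hM, hΩM⟩ := hΩb.subset_ball_lt 0 0
  rw [ENNReal.tendsto_nhds_zero]
  intro δ hδ
  obtain ⟨δ', hδ', hδδ⟩ : ∃ δ' : ℝ, 0 < δ' ∧ ENNReal.ofReal δ' + ENNReal.ofReal δ' ≤ δ := by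
    rcases eq_or_ne δ ⊤ with rfl | hδt
    · exact ⟨1, one_pos, le_top⟩
    · have h1 : 0 < δ.toReal := ENNReal.toReal_pos hδ.ne' hδt
      refine ⟨δ.toReal / 2, by positivity, ?_⟩
      rw [← ENNReal.ofReal_add (by positivity) (by positivity), add_halves,
        ENNReal.ofReal_toReal hδt]
  set X := Real.exp (α * |B| ^ ((n : ℝ) / ((n : ℝ) - 1))) with hX
  have hlim : Tendsto (fun ε : ℝ => ENNReal.ofReal X *
      ∫⁻ x in Metric.ball (0 : Eucl n) ε, ENNReal.ofReal (1 / ‖x‖ ^ β)) (𝓝[>] 0) (𝓝 0) := by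
    have := ENNReal.Tendsto.const_mul (a := ENNReal.ofReal X)
      (tendsto_lintegral_ball_norm_rpow hn hβn) (Or.inr ENNReal.ofReal_ne_top)
    rwa [mul_zero] at this
  obtain ⟨ε, hε, hεr, hεδ⟩ := ((eventually_mem_nhdsWithin (a := (0 : ℝ)) (s := Ioi 0)).and
    ((eventually_nhdsWithin_of_eventually_nhds (eventually_lt_nhds hr)).and
      (hlim.eventually_lt_const (ENNReal.ofReal_pos.2 hδ')))).exists
  have hε0 : 0 < ε := hε
  obtain ⟨κ, hκ, hexp⟩ := exists_lintegral_exp_bound hn hM hε0 hα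
    (δ := δ' * ε ^ β) (by positivity)
  filter_upwards [hB, (hconc.tendsto_energy hn0 hΩ (half_pos hε0)).eventually_lt_const hκ]
    with j hj1 hj2
  refine le_trans ?_ hδδ
  rw [F, ← lintegral_inter_add_sdiff _ Ω (Metric.isOpen_ball (x := (0 : Eucl n)) (ε := ε)).measurableSet]
  refine add_le_add ?_ ?_
  · refine le_trans ?_ hεδ.le
    rw [← lintegral_const_mul' _ _ ENNReal.ofReal_ne_top]
    refine (setLIntegral_mono' (hΩ.inter Metric.isOpen_ball).measurableSet fun x hx => ?_).trans
      (lintegral_mono_set inter_subset_right)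
    rw [← ENNReal.ofReal_mul (Real.exp_pos _).le]
    refine ENNReal.ofReal_le_ofReal ?_
    rw [mul_one_div]
    have h1 := (hj1 x ⟨hx.1, Metric.ball_subset_ball hεr.le hx.2⟩).trans (le_abs_self B)
    gcongr
    have h2 : Real.exp (α * |u j x| ^ ((n : ℝ) / ((n : ℝ) - 1))) ≤ X := by
      rw [hX]
      gcongr
    linarith
  · have h1 := hexp _ _ ((hu j).isSobolevLimit hΩ)
      (fun x hx => indicator_of_notMem (fun h => by
        have := mem_ball_zero_iff.1 (hΩM h)
        linarith) _) hj2 (Ω \ Metric.ball 0 ε)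
      (hΩ.measurableSet.diff Metric.isOpen_ball.measurableSet) (sdiff_subset.trans hΩM) ?_
    · have hm : MeasurableSet (Ω \ Metric.ball (0 : Eucl n) ε) :=
        hΩ.measurableSet.diff Metric.isOpen_ball.measurableSet
      calc _ ≤ ∫⁻ x in Ω \ Metric.ball 0 ε, ENNReal.ofReal (1 / ε ^ β) * ENNReal.ofReal
            (Real.exp (α * |Ω.indicator (u j) x| ^ ((n : ℝ) / ((n : ℝ) - 1))) - 1) := by
            refine setLIntegral_mono' hm fun x hx => ?_
            rw [indicator_of_mem hx.1, ← ENNReal.ofReal_mul (by positivity)]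
            refine ENNReal.ofReal_le_ofReal ?_
            have hεx : ε ≤ ‖x‖ := by
              have := hx.2
              rwa [mem_ball_zero_iff, not_lt] at this
            have h3 : 0 ≤ Real.exp (α * |u j x| ^ ((n : ℝ) / ((n : ℝ) - 1))) - 1 := by
              rw [sub_nonneg]
              exact Real.one_le_exp (by positivity)
            rw [one_div_mul_eq_div]
            gcongr
        _ ≤ ENNReal.ofReal (1 / ε ^ β) * ENNReal.ofReal (δ' * ε ^ β) := by
            rw [lintegral_const_mul' _ _ ENNReal.ofReal_ne_top]
            gcongr
        _ = ENNReal.ofReal δ' := by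
            rw [← ENNReal.ofReal_mul (by positivity)]
            congr 1
            field_simp
    · intro x hx
      refine ⟨continuousAt_indicator_of_mem hΩ (huc j) hx.1, ?_⟩
      have := hx.2
      rwa [mem_ball_zero_iff, not_lt] at this

end ExponentialIntegrability

/-! ### Test functions as elements of the Sobolev space -/

section TestFunctions

theorem IsTestFunction.hasWeakGradient {n : ℕ} {Ω : Set (Eucl n)} {φ : Eucl n → ℝ}
    (hφ : IsTestFunction Ω φ) : HasWeakGradient Ω φ (gradient φ) := by
  obtain ⟨hs, hc, hΩ⟩ := hφ
  have hgc := continuous_gradient hs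
  refine ⟨(hs.continuous.locallyIntegrable).locallyIntegrableOn _,
    hgc.locallyIntegrable.locallyIntegrableOn _, ?_⟩
  rintro ψ ⟨ks, kc, kΩ⟩
  have kgc := continuous_gradient ks
  rw [setIntegral_eq_integral_of_forall_compl_eq_zero, setIntegral_eq_integral_of_forall_compl_eq_zero]
  · have i1 : Integrable (fun x => φ x • gradient ψ x) :=
      (hs.continuous.smul kgc).integrable_of_hasCompactSupport hc.smul_right
    have i2 : Integrable (fun x => ψ x • gradient φ x) :=
      (ks.continuous.smul hgc).integrable_of_hasCompactSupport kc.smul_right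
    refine ext_inner_right ℝ fun w => ?_
    have hfw : Continuous fun x => fderiv ℝ φ x w :=
      (hs.continuous_fderiv (by simp)).clm_apply continuous_const
    have kfw : Continuous fun x => fderiv ℝ ψ x w :=
      (ks.continuous_fderiv (by simp)).clm_apply continuous_const
    have hin : ∀ (χ : Eucl n → ℝ) x, inner ℝ w (gradient χ x) = fderiv ℝ χ x w := fun χ x => by
      rw [real_inner_comm]
      exact InnerProductSpace.toDual_symm_apply
    rw [inner_neg_left, real_inner_comm, real_inner_comm w (∫ x, ψ x • gradient φ x),
      ← integral_inner i1, ← integral_inner i2]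
    simp only [inner_smul_right, hin]
    rw [integral_mul_fderiv_eq_neg_fderiv_mul_of_integrable]
    · simp only [mul_comm]
    · exact (hfw.mul ks.continuous).integrable_of_hasCompactSupport kc.mul_left
    · exact (hs.continuous.mul kfw).integrable_of_hasCompactSupport hc.mul_right
    · exact (hs.continuous.mul ks.continuous).integrable_of_hasCompactSupport hc.mul_right
    · exact fun x _ => (hs.differentiable (by simp)).differentiableAt
    · exact fun x _ => (ks.differentiable (by simp)).differentiableAt
  · intro x hx
    rw [image_eq_zero_of_notMem_tsupport fun h => hx (kΩ h), zero_smul]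
  · intro x hx
    rw [image_eq_zero_of_notMem_tsupport fun h => hx (hΩ h), zero_smul]

/-- `weakGrad` is an arbitrary choice, so it agrees with the classical gradient only almost
everywhere, by the fundamental lemma of the calculus of variations. -/
theorem IsTestFunction.weakGrad_ae_eq {n : ℕ} {Ω : Set (Eucl n)} (hΩ : IsOpen Ω) {φ : Eucl n → ℝ}
    (hφ : IsTestFunction Ω φ) : weakGrad Ω φ =ᵐ[volume.restrict Ω] gradient φ := by
  have hex : ∃ G, HasWeakGradient Ω φ G := ⟨_, hφ.hasWeakGradient⟩
  have hw : HasWeakGradient Ω φ (weakGrad Ω φ) := by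
    rw [weakGrad, dif_pos hex]
    exact hex.choose_spec
  have hg := hφ.hasWeakGradient
  have h0 := hΩ.ae_eq_zero_of_integral_contDiff_smul_eq_zero (μ := volume)
    (f := fun x => weakGrad Ω φ x - gradient φ x) (hw.2.1.sub hg.2.1) ?_
  · rw [EventuallyEq, ae_restrict_iff' hΩ.measurableSet]
    filter_upwards [h0] with x hx hxΩ
    exact sub_eq_zero.1 (hx hxΩ)
  · intro ψ ks kc kΩ
    have key : ∀ G : Eucl n → Eucl n, LocallyIntegrableOn G Ω volume →
        IntegrableOn (fun x => ψ x • G x) Ω ∧ ∫ x in Ω, ψ x • G x = ∫ x, ψ x • G x := by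
      intro G hG
      constructor
      · have h1 : IntegrableOn G (tsupport ψ) := hG.integrableOn_compact_subset kΩ kc
        have h2 : IntegrableOn (fun x => ψ x • G x) (tsupport ψ) :=
          h1.continuousOn_smul ks.continuous.continuousOn kc
        refine ((integrableOn_iff_integrable_of_support_subset ?_).1 h2).integrableOn
        intro x hx
        refine subset_tsupport _ fun h => hx ?_
        simp [h]
      · refine setIntegral_eq_integral_of_forall_compl_eq_zero fun x hx => ?_
        rw [image_eq_zero_of_notMem_tsupport fun h => hx (kΩ h), zero_smul]
    have e1 := hw.2.2 ψ ⟨ks, kc, kΩ⟩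
    have e2 := hg.2.2 ψ ⟨ks, kc, kΩ⟩
    obtain ⟨j1, k1⟩ := key _ hw.2.1
    obtain ⟨j2, k2⟩ := key _ hg.2.1
    have e3 : ∫ x, ψ x • (weakGrad Ω φ x - gradient φ x) =
        ∫ x in Ω, ψ x • (weakGrad Ω φ x - gradient φ x) := by
      refine (setIntegral_eq_integral_of_forall_compl_eq_zero fun x hx => ?_).symm
      rw [image_eq_zero_of_notMem_tsupport fun h => hx (kΩ h), zero_smul]
    rw [e3]
    simp only [smul_sub]
    rw [integral_sub j1 j2, sub_eq_zero]
    exact neg_injective (e1.symm.trans e2)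

theorem hasCompactSupport_gradient {n : ℕ} {φ : Eucl n → ℝ} (hφ : HasCompactSupport φ) :
    HasCompactSupport (gradient φ) :=
  (hφ.fderiv (𝕜 := ℝ)).comp_left (g := (InnerProductSpace.toDual ℝ (Eucl n)).symm) (map_zero _)

theorem IsTestFunction.memW1n0 {n : ℕ} {Ω : Set (Eucl n)} (hΩ : IsOpen Ω) {φ : Eucl n → ℝ}
    (hφ : IsTestFunction Ω φ) : MemW1n0 Ω φ := by
  have hae := hφ.weakGrad_ae_eq hΩ
  refine ⟨⟨⟨_, hφ.hasWeakGradient⟩,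
    (hφ.1.continuous.memLp_of_hasCompactSupport hφ.2.1).restrict _, ?_⟩, ?_⟩
  · exact (memLp_congr_ae hae).2 (((continuous_gradient hφ.1).memLp_of_hasCompactSupport
      (hasCompactSupport_gradient hφ.2.1)).restrict _)
  · intro ε hε
    refine ⟨φ, hφ, ?_, ?_⟩
    · simpa using hε
    · have : (fun x => weakGrad Ω φ x - gradient φ x) =ᵐ[volume.restrict Ω] 0 := by
        filter_upwards [hae] with x hx
        rw [hx, sub_self]
        rfl
      rw [eLpNorm_congr_ae this, eLpNorm_zero]
      exact hε

end TestFunctions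

/-! ### Smoothed truncated logarithms -/

section MoserFunctions

/-- A smooth increasing profile that vanishes on `(-∞, 0]`, is constant on `[L, ∞)` and has slope
`1` on `[1, L - 1]`. -/
noncomputable def moserProfile (L t : ℝ) : ℝ :=
  ∫ s in (0 : ℝ)..t, Real.smoothTransition s * Real.smoothTransition (L - s)

theorem continuous_moserSlope (L : ℝ) :
    Continuous fun s => Real.smoothTransition s * Real.smoothTransition (L - s) :=
  Real.smoothTransition.continuous.mul
    (Real.smoothTransition.continuous.comp (continuous_const.sub continuous_id))

theorem hasDerivAt_moserProfile (L t : ℝ) : HasDerivAt (moserProfile L)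
    (Real.smoothTransition t * Real.smoothTransition (L - t)) t :=
  intervalIntegral.integral_hasDerivAt_right ((continuous_moserSlope L).intervalIntegrable _ _)
    ((continuous_moserSlope L).stronglyMeasurableAtFilter _ _) (continuous_moserSlope L).continuousAt

theorem contDiff_moserProfile (L : ℝ) : ContDiff ℝ ∞ (moserProfile L) := by
  rw [contDiff_infty_iff_deriv]
  refine ⟨fun t => (hasDerivAt_moserProfile L t).differentiableAt, ?_⟩
  have : deriv (moserProfile L) = fun s => Real.smoothTransition s * Real.smoothTransition (L - s) :=
    funext fun t => (hasDerivAt_moserProfile L t).deriv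
  rw [this]
  exact Real.smoothTransition.contDiff.mul
    (Real.smoothTransition.contDiff.comp (contDiff_const.sub contDiff_id))

theorem moserProfile_of_nonpos {L t : ℝ} (ht : t ≤ 0) : moserProfile L t = 0 := by
  have : ∫ s in (0 : ℝ)..t, Real.smoothTransition s * Real.smoothTransition (L - s) =
      ∫ s in (0 : ℝ)..t, (0 : ℝ) := by
    refine intervalIntegral.integral_congr fun s hs => ?_
    rw [uIcc_of_ge ht] at hs
    rw [Real.smoothTransition.zero_of_nonpos hs.2, zero_mul]
  rw [moserProfile, this, intervalIntegral.integral_zero]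

theorem moserProfile_of_ge {L t : ℝ} (ht : L ≤ t) : moserProfile L t = moserProfile L L := by
  have : ∫ s in L..t, Real.smoothTransition s * Real.smoothTransition (L - s) =
      ∫ s in L..t, (0 : ℝ) := by
    refine intervalIntegral.integral_congr fun s hs => ?_
    rw [uIcc_of_le ht] at hs
    rw [Real.smoothTransition.zero_of_nonpos (sub_nonpos.2 hs.1), mul_zero]
  rw [moserProfile, moserProfile, ← intervalIntegral.integral_add_adjacent_intervals
    ((continuous_moserSlope L).intervalIntegrable 0 L)
    ((continuous_moserSlope L).intervalIntegrable L t), this, intervalIntegral.integral_zero,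
    add_zero]

theorem sub_two_le_moserProfile {L : ℝ} (hL : 2 ≤ L) : L - 2 ≤ moserProfile L L := by
  have h1 : ∫ s in (1 : ℝ)..(L - 1), Real.smoothTransition s * Real.smoothTransition (L - s) =
      ∫ s in (1 : ℝ)..(L - 1), (1 : ℝ) := by
    refine intervalIntegral.integral_congr fun s hs => ?_
    rw [uIcc_of_le (by linarith)] at hs
    rw [Real.smoothTransition.one_of_one_le hs.1,
      Real.smoothTransition.one_of_one_le (by linarith [hs.2]), mul_one]
  have h2 : ∫ s in (1 : ℝ)..(L - 1), Real.smoothTransition s * Real.smoothTransition (L - s) ≤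
      moserProfile L L :=
    intervalIntegral.integral_mono_interval zero_le_one (by linarith) (by linarith)
      (Eventually.of_forall fun s => mul_nonneg (Real.smoothTransition.nonneg _)
        (Real.smoothTransition.nonneg _)) ((continuous_moserSlope L).intervalIntegrable _ _)
  rw [h1, intervalIntegral.integral_const, smul_eq_mul, mul_one] at h2
  linarith

open Classical in
/-- A smooth version of the truncated logarithm `min (L, log (R / |x|))⁺`. -/
noncomputable def moserFun (n : ℕ) (R L : ℝ) (x : Eucl n) : ℝ :=
  if x = 0 then moserProfile L L else moserProfile L (Real.log R - Real.log ‖x‖)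

variable {n : ℕ} {R L : ℝ}

theorem moserFun_eq_of_ne {x : Eucl n} (hx : x ≠ 0) :
    moserFun n R L x = moserProfile L (Real.log R - Real.log ‖x‖) := if_neg hx

theorem moserFun_eq_const (hR : 0 < R) {x : Eucl n} (hx : ‖x‖ ≤ R * Real.exp (-L)) :
    moserFun n R L x = moserProfile L L := by
  by_cases h0 : x = 0
  · exact if_pos h0
  · rw [moserFun_eq_of_ne h0]
    refine moserProfile_of_ge ?_
    have h1 := Real.log_le_log (norm_pos_iff.2 h0) hx
    rw [Real.log_mul hR.ne' (Real.exp_pos _).ne', Real.log_exp] at h1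
    linarith

theorem moserFun_eq_zero (hR : 0 < R) {x : Eucl n} (hx : R ≤ ‖x‖) : moserFun n R L x = 0 := by
  have h0 : x ≠ 0 := norm_pos_iff.1 (hR.trans_le hx)
  rw [moserFun_eq_of_ne h0]
  refine moserProfile_of_nonpos ?_
  have h1 := Real.log_le_log hR hx
  linarith

theorem moserFun_eventuallyEq {x : Eucl n} (hx : x ≠ 0) :
    moserFun n R L =ᶠ[𝓝 x] fun y => moserProfile L (Real.log R - Real.log ‖y‖) := by
  filter_upwards [isOpen_ne.mem_nhds hx] with y hy
  exact moserFun_eq_of_ne hy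

theorem moserFun_eventuallyEq_zero (hR : 0 < R) :
    moserFun n R L =ᶠ[𝓝 0] fun _ => moserProfile L L := by
  filter_upwards [Metric.ball_mem_nhds (0 : Eucl n) (by positivity : 0 < R * Real.exp (-L))]
    with y hy
  exact moserFun_eq_const hR (mem_ball_zero_iff.1 hy).le

theorem contDiff_moserFun (hR : 0 < R) : ContDiff ℝ ∞ (moserFun n R L) := by
  rw [contDiff_iff_contDiffAt]
  intro x
  by_cases hx : x = 0
  · subst hx
    exact contDiffAt_const.congr_of_eventuallyEq (moserFun_eventuallyEq_zero hR)
  · refine ContDiffAt.congr_of_eventuallyEq ?_ (moserFun_eventuallyEq hx)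
    refine (contDiff_moserProfile L).contDiffAt.comp x ?_
    exact contDiffAt_const.sub ((contDiffAt_norm ℝ hx).log (norm_ne_zero_iff.2 hx))

theorem norm_gradient_moserFun {x : Eucl n} (hx : x ≠ 0) :
    ‖gradient (moserFun n R L) x‖ = Real.smoothTransition (Real.log R - Real.log ‖x‖) *
      Real.smoothTransition (L - (Real.log R - Real.log ‖x‖)) * ‖x‖⁻¹ := by
  have : Nontrivial (Eucl n) := ⟨x, 0, hx⟩
  have hd : DifferentiableAt ℝ (fun y : Eucl n => ‖y‖) x :=
    (contDiffAt_norm ℝ (n := 1) hx).differentiableAt (by simp)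
  have h1 := (hasDerivAt_moserProfile L (Real.log R - Real.log ‖x‖)).comp_hasFDerivAt x
    ((hd.hasFDerivAt.log (norm_ne_zero_iff.2 hx)).const_sub (Real.log R))
  rw [norm_gradient, ((moserFun_eventuallyEq hx).hasFDerivAt_iff.2 h1).fderiv, norm_smul, norm_neg,
    norm_smul, norm_fderiv_norm hd, mul_one, norm_inv, norm_norm, Real.norm_eq_abs, abs_of_nonneg]
  exact mul_nonneg (Real.smoothTransition.nonneg _) (Real.smoothTransition.nonneg _)

theorem gradient_moserFun_zero (hR : 0 < R) : gradient (moserFun n R L) 0 = 0 := by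
  rw [← norm_eq_zero, norm_gradient, (moserFun_eventuallyEq_zero hR).fderiv_eq,
    fderiv_const_apply, norm_zero]

theorem tsupport_moserFun_subset (hR : 0 < R) :
    tsupport (moserFun n R L) ⊆ Metric.closedBall 0 R := by
  refine closure_minimal (fun x hx => ?_) Metric.isClosed_closedBall
  rw [mem_closedBall_zero_iff]
  by_contra! h
  exact hx (moserFun_eq_zero hR h.le)

theorem isTestFunction_moserFun (hR : 0 < R) {Ω : Set (Eucl n)} (hΩ : Metric.closedBall 0 R ⊆ Ω) :
    IsTestFunction Ω (moserFun n R L) :=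
  ⟨contDiff_moserFun hR,
    (isCompact_closedBall _ _).of_isClosed_subset (isClosed_tsupport _) (tsupport_moserFun_subset hR),
    (tsupport_moserFun_subset hR).trans hΩ⟩

end MoserFunctions

/-! ### The Moser sequence and positivity of the concentration level -/

section MoserSequence

theorem sphereArea_pos {n : ℕ} (hn : 2 ≤ n) : 0 < sphereArea n := by
  have := nontrivial_eucl hn
  rw [sphereArea, Measure.toSphere_real_apply_univ, finrank_euclideanSpace_fin]
  have : 0 < volume.real (Metric.ball (0 : Eucl n) 1) :=
    ENNReal.toReal_pos (Metric.measure_ball_pos volume _ one_pos).ne' measure_ball_lt_top.ne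
  positivity

theorem lintegral_annulus_norm_inv_pow {n : ℕ} (hn : 2 ≤ n) {a b : ℝ} (ha : 0 < a) (hab : a ≤ b) :
    ∫⁻ x in {x : Eucl n | ‖x‖ ∈ Ioo a b}, ENNReal.ofReal ((‖x‖⁻¹) ^ n) =
      ENNReal.ofReal (sphereArea n * Real.log (b / a)) := by
  have := nontrivial_eucl hn
  set f : ℝ → ℝ := (Ioo a b).indicator fun t => t⁻¹ ^ n with hf
  have hf0 : ∀ t, 0 ≤ f t := fun t => indicator_nonneg (fun s hs => by
    have : 0 < s := ha.trans hs.1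
    positivity) t
  have hfi : (fun y : ℝ => y ^ (n - 1) • f y) = (Ioo a b).indicator fun t => t⁻¹ := by
    ext y
    by_cases hy : y ∈ Ioo a b
    · have hy0 : y ≠ 0 := (ha.trans hy.1).ne'
      rw [hf, indicator_of_mem hy, indicator_of_mem hy, smul_eq_mul]
      obtain ⟨m, rfl⟩ : ∃ m, n = m + 1 := ⟨n - 1, by omega⟩
      rw [Nat.add_sub_cancel, pow_succ, ← mul_assoc, ← mul_pow, mul_inv_cancel₀ hy0, one_pow,
        one_mul]
    · rw [hf, indicator_of_notMem hy, indicator_of_notMem hy, smul_zero]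
  have hinv : IntegrableOn (fun t : ℝ => t⁻¹) (Ioo a b) := by
    have : IntegrableOn (fun t : ℝ => t⁻¹) (Icc a b) :=
      (continuousOn_id.inv₀ fun t ht => (ha.trans_le ht.1).ne').integrableOn_Icc
    exact this.mono_set Ioo_subset_Icc_self
  have hsub : Ioo a b ∩ Ioi 0 = Ioo a b := inter_eq_left.2 fun t ht => ha.trans ht.1
  have hint : Integrable (fun x : Eucl n => f ‖x‖) := by
    rw [integrable_fun_norm_addHaar volume (f := f), finrank_euclideanSpace_fin, hfi]
    exact ((integrable_indicator_iff measurableSet_Ioo).2 hinv).integrableOn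
  have h1 : ∫ x : Eucl n, f ‖x‖ = sphereArea n * Real.log (b / a) := by
    rw [integral_fun_norm_addHaar volume f, finrank_euclideanSpace_fin, hfi, sphereArea,
      Measure.toSphere_real_apply_univ, finrank_euclideanSpace_fin, nsmul_eq_mul, smul_eq_mul,
      setIntegral_indicator measurableSet_Ioo, inter_comm, hsub, ← integral_Ioc_eq_integral_Ioo,
      ← intervalIntegral.integral_of_le hab, integral_inv_of_pos ha (ha.trans_le hab)]
    ring
  rw [← h1, ofReal_integral_eq_lintegral_ofReal hint (Eventually.of_forall fun x => hf0 _)]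
  have hm : MeasurableSet {x : Eucl n | ‖x‖ ∈ Ioo a b} := measurable_norm measurableSet_Ioo
  rw [← lintegral_indicator hm]
  refine lintegral_congr fun x => ?_
  by_cases hx : ‖x‖ ∈ Ioo a b
  · rw [indicator_of_mem (show x ∈ {x : Eucl n | ‖x‖ ∈ Ioo a b} from hx), hf, indicator_of_mem hx]
  · rw [indicator_of_notMem (show x ∉ {x : Eucl n | ‖x‖ ∈ Ioo a b} from hx), hf,
      indicator_of_notMem hx, ENNReal.ofReal_zero]

variable {n : ℕ} {R L : ℝ}

theorem enorm_pow_eq_ofReal {E : Type*} [NormedAddCommGroup E] (w : E) (n : ℕ) :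
    ‖w‖ₑ ^ n = ENNReal.ofReal (‖w‖ ^ n) := by
  rw [ENNReal.ofReal_pow (norm_nonneg _), ofReal_norm]

theorem norm_gradient_moserFun_le (hR : 0 < R) (x : Eucl n) :
    ‖gradient (moserFun n R L) x‖ ≤ ‖x‖⁻¹ := by
  by_cases hx : x = 0
  · rw [hx, gradient_moserFun_zero hR, norm_zero, inv_zero]
  · rw [norm_gradient_moserFun hx]
    refine mul_le_of_le_one_left (by positivity) ?_
    exact mul_le_one₀ (Real.smoothTransition.le_one _) (Real.smoothTransition.nonneg _)
      (Real.smoothTransition.le_one _)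

theorem lintegral_gradient_moserFun_le (hn : 2 ≤ n) (hR : 0 < R) (hL : 0 ≤ L) :
    ∫⁻ x, ‖gradient (moserFun n R L) x‖ₑ ^ n ≤ ENNReal.ofReal (sphereArea n * L) := by
  have hn0 : n ≠ 0 := by omega
  have hρ : R * Real.exp (-L) ≤ R := mul_le_of_le_one_right hR.le (Real.exp_le_one_iff.2 (by linarith))
  have h1 := lintegral_annulus_norm_inv_pow hn (a := R * Real.exp (-L)) (b := R) (by positivity) hρ
  have e : R / (R * Real.exp (-L)) = Real.exp L := by
    rw [Real.exp_neg]
    field_simp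
  rw [e, Real.log_exp] at h1
  have hm : MeasurableSet {x : Eucl n | ‖x‖ ∈ Ioo (R * Real.exp (-L)) R} :=
    measurable_norm measurableSet_Ioo
  rw [← h1, ← lintegral_indicator hm]
  refine lintegral_mono fun x => ?_
  rw [enorm_pow_eq_ofReal]
  by_cases hx : ‖x‖ ∈ Ioo (R * Real.exp (-L)) R
  · rw [indicator_of_mem (show x ∈ {x : Eucl n | ‖x‖ ∈ Ioo (R * Real.exp (-L)) R} from hx)]
    refine ENNReal.ofReal_le_ofReal ?_
    have := norm_gradient_moserFun_le (L := L) hR x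
    gcongr
  · rw [indicator_of_notMem (show x ∉ {x : Eucl n | ‖x‖ ∈ Ioo (R * Real.exp (-L)) R} from hx)]
    have : ‖gradient (moserFun n R L) x‖ = 0 := by
      by_cases hx0 : x = 0
      · rw [hx0, gradient_moserFun_zero hR, norm_zero]
      · have hxn : 0 < ‖x‖ := norm_pos_iff.2 hx0
        rw [norm_gradient_moserFun hx0]
        rcases le_or_gt ‖x‖ (R * Real.exp (-L)) with h2 | h2
        · have h3 := Real.log_le_log hxn h2
          rw [Real.log_mul hR.ne' (Real.exp_pos _).ne', Real.log_exp] at h3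
          rw [Real.smoothTransition.zero_of_nonpos (x := L - _) (by linarith), mul_zero, zero_mul]
        · have h4 : R ≤ ‖x‖ := by
            by_contra! h5
            exact hx ⟨h2, h5⟩
          have h3 := Real.log_le_log hR h4
          rw [Real.smoothTransition.zero_of_nonpos (x := Real.log R - _) (by linarith), zero_mul,
            zero_mul]
    rw [this, zero_pow hn0, ENNReal.ofReal_zero]

/-- The gradient has norm exactly 1/|x| on an annulus of logarithmic width L - 2, against L for the
upper bound. This bounded loss is harmless for the exponential. -/
theorem le_lintegral_gradient_moserFun (hn : 2 ≤ n) (hR : 0 < R) (hL : 2 ≤ L) :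
    ENNReal.ofReal (sphereArea n * (L - 2)) ≤ ∫⁻ x, ‖gradient (moserFun n R L) x‖ₑ ^ n := by
  have h1 := lintegral_annulus_norm_inv_pow hn (a := R * Real.exp (-(L - 1)))
    (b := R * Real.exp (-1)) (by positivity)
    (mul_le_mul_of_nonneg_left (Real.exp_le_exp.2 (by linarith)) hR.le)
  have e : R * Real.exp (-1) / (R * Real.exp (-(L - 1))) = Real.exp (L - 2) := by
    rw [mul_div_mul_left _ _ hR.ne', ← Real.exp_sub]
    congr 1
    ring
  rw [e, Real.log_exp] at h1
  have hm : MeasurableSet {x : Eucl n | ‖x‖ ∈ Ioo (R * Real.exp (-(L - 1))) (R * Real.exp (-1))} :=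
    measurable_norm measurableSet_Ioo
  rw [← h1]
  refine (setLIntegral_mono' hm fun x hx => ?_).trans (setLIntegral_le_lintegral _ _)
  have hxn : 0 < ‖x‖ := lt_trans (by positivity) hx.1
  rw [enorm_pow_eq_ofReal, norm_gradient_moserFun (norm_pos_iff.1 hxn)]
  have h3 := Real.log_le_log (by positivity) hx.1.le
  have h4 := Real.log_le_log hxn hx.2.le
  rw [Real.log_mul hR.ne' (Real.exp_pos _).ne', Real.log_exp] at h3 h4
  rw [Real.smoothTransition.one_of_one_le (by linarith),
    Real.smoothTransition.one_of_one_le (by linarith), one_mul, one_mul]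

/-- The exponent of the Moser functions on their plateau. -/
theorem le_plateau_exponent (hn : 2 ≤ n) {α β a H : ℝ} (hβn : β < n)
    (hαβ : α / alphaCrit n + β / n = 1) (hL : 2 < L) (ha : 0 < a) (haL : a ≤ sphereArea n * L)
    (hH : L - 2 ≤ H) :
    (n - β) * (L - 4) ≤ α * |(a ^ (1 / (n : ℝ)))⁻¹ * H| ^ ((n : ℝ) / ((n : ℝ) - 1)) := by
  have hω := sphereArea_pos hn
  have hn2 : (2 : ℝ) ≤ n := by exact_mod_cast hn
  have hn1 : (0 : ℝ) < (n : ℝ) - 1 := by linarith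
  have hnR : (0 : ℝ) < n := by linarith
  have hL0 : 0 < L := by linarith
  have hH0 : 0 ≤ H := by linarith
  set σ := sphereArea n
  set q : ℝ := 1 / ((n : ℝ) - 1) with hq
  have hq0 : 0 < q := by positivity
  have hp : (n : ℝ) / ((n : ℝ) - 1) = 1 + q := by rw [hq]; field_simp; ring
  have hq1 : q ≤ 1 := by rw [hq, div_le_one hn1]; linarith
  -- The critical relation between α and β, solved for α.
  have hα : α = (n - β) * σ ^ q := by
    have hc : alphaCrit n = n * σ ^ q := rfl
    rw [hc] at hαβ
    have : 0 < σ ^ q := by positivity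
    field_simp at hαβ
    linarith
  have h1 : ((a ^ (1 / (n : ℝ)))⁻¹) ^ (1 + q) = (a ^ q)⁻¹ := by
    rw [← Real.rpow_neg ha.le, ← Real.rpow_mul ha.le, ← Real.rpow_neg ha.le, ← hp, hq]
    congr 1
    field_simp
  have h2 : (σ ^ q * L ^ q)⁻¹ ≤ (a ^ q)⁻¹ := by
    rw [← Real.mul_rpow hω.le hL0.le]
    have := Real.rpow_le_rpow ha.le haL hq0.le
    gcongr
  -- Bernoulli: (1 - 2/L)^{1+q} ≥ 1 - 2(1 + q)/L, and q ≤ 1 because n ≥ 2.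
  have h3 : L ^ q * (L - 4) ≤ (L - 2) ^ (1 + q) := by
    have h4 := one_add_mul_self_le_rpow_one_add (s := -(2 / L)) (p := 1 + q)
      (by rw [neg_le_neg_iff, div_le_one hL0]; exact hL.le) (by linarith)
    have h5 : (L - 2) ^ (1 + q) = L ^ q * L * (1 + -(2 / L)) ^ (1 + q) := by
      have e1 : L - 2 = L * (1 + -(2 / L)) := by field_simp; ring
      have e2 : 0 ≤ 1 + -(2 / L) := by
        rw [← sub_eq_add_neg, sub_nonneg, div_le_one hL0]
        exact hL.le
      rw [e1, Real.mul_rpow hL0.le e2, Real.rpow_add hL0, Real.rpow_one, mul_comm L (L ^ q)]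
    rw [h5, mul_assoc]
    refine mul_le_mul_of_nonneg_left ?_ (by positivity)
    have h6 : L * (1 + (1 + q) * -(2 / L)) = L - 2 * (1 + q) := by field_simp; ring
    have h7 := mul_le_mul_of_nonneg_left h4 hL0.le
    linarith
  have h8 : (L - 2) ^ (1 + q) ≤ H ^ (1 + q) :=
    Real.rpow_le_rpow (by linarith) hH (by linarith)
  rw [hp, abs_of_nonneg (by positivity), Real.mul_rpow (by positivity) hH0, h1, hα]
  have hs : 0 < (n : ℝ) - β := by linarith
  have hω' : 0 < σ ^ q := by positivity
  have hL' : 0 < L ^ q := by positivity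
  calc ((n : ℝ) - β) * (L - 4) = (n - β) * σ ^ q * ((σ ^ q * L ^ q)⁻¹ * (L ^ q * (L - 4))) := by
        field_simp
    _ ≤ (n - β) * σ ^ q * ((σ ^ q * L ^ q)⁻¹ * (H ^ (1 + q))) := by
        gcongr
        exact h3.trans h8
    _ ≤ _ := by gcongr

/-- On its plateau, of radius ρ = R e^{-L}, the normalized Moser function has exponent at least (n -
β)(L - 4), while ρ^n/ρ^β is of order e^{-L(n-β)}. At the critical relation the two balance and F
stays bounded below as L grows; away from 0 the energy is of order 1/L. -/
theorem exists_moser_competitor (hn : 2 ≤ n) {Ω : Set (Eucl n)} (hΩ : IsOpen Ω) (hR : 0 < R)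
    (hRΩ : Metric.closedBall 0 R ⊆ Ω) {α β : ℝ} (hβ : 0 ≤ β) (hβn : β < n)
    (hαβ : α / alphaCrit n + β / n = 1) (hL : 4 ≤ L) :
    ∃ v ∈ unitBall Ω, gradNorm Ω v = 1 ∧
      (∀ ε : ℝ, 0 < ε → ∫⁻ x in Ω \ Metric.ball 0 ε, ‖weakGrad Ω v x‖ₑ ^ n ≤
        ENNReal.ofReal ((sphereArea n * (L - 2))⁻¹ * ε⁻¹ ^ n) * volume Ω) ∧
      ENNReal.ofReal (volume.real (Metric.ball (0 : Eucl n) 1) * R ^ ((n : ℝ) - β) *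
        (Real.exp (-4 * (n - β)) - Real.exp (-L * (n - β)))) ≤ F α β Ω v := by
  have hn0 : n ≠ 0 := by omega
  have hω := sphereArea_pos hn
  set φ := moserFun n R L with hφ
  set A := ∫⁻ x, ‖gradient φ x‖ₑ ^ n with hA
  have hAle := lintegral_gradient_moserFun_le hn hR (L := L) (by linarith)
  have hAge := le_lintegral_gradient_moserFun hn hR (L := L) (by linarith)
  have hAtop : A ≠ ⊤ := ne_top_of_le_ne_top ENNReal.ofReal_ne_top hAle
  set a := A.toReal with ha
  have hAa : A = ENNReal.ofReal a := (ENNReal.ofReal_toReal hAtop).symm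
  have hale : a ≤ sphereArea n * L := ENNReal.toReal_le_of_le_ofReal (by positivity) hAle
  have hage : sphereArea n * (L - 2) ≤ a := (ENNReal.ofReal_le_iff_le_toReal hAtop).1 hAge
  have hL2 : 0 < sphereArea n * (L - 2) := mul_pos hω (by linarith)
  have ha0 : 0 < a := hL2.trans_le hage
  set c := (a ^ (1 / (n : ℝ)))⁻¹ with hc
  have hc0 : 0 < c := by positivity
  have hcn : c ^ n = a⁻¹ := by
    rw [hc, inv_pow, one_div, Real.rpow_inv_natCast_pow ha0.le hn0]
  have hφt : IsTestFunction Ω φ := isTestFunction_moserFun hR hRΩ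
  set v : Eucl n → ℝ := fun x => c * φ x with hv
  have hvt : IsTestFunction Ω v := by
    refine ⟨contDiff_const.mul hφt.1, hφt.2.1.mul_left, ?_⟩
    exact (tsupport_mul_subset_right (f := fun _ => c) (g := φ)).trans hφt.2.2
  have hgv : ∀ x, ‖gradient v x‖ = c * ‖gradient φ x‖ := by
    intro x
    have hd : DifferentiableAt ℝ φ x := (hφt.1.differentiable (by simp)).differentiableAt
    rw [norm_gradient, norm_gradient, hv, fderiv_const_mul hd, norm_smul, Real.norm_eq_abs,
      abs_of_pos hc0]
  have hgv' : ∀ x, ‖gradient v x‖ₑ ^ n = ENNReal.ofReal (a⁻¹) * ‖gradient φ x‖ₑ ^ n := by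
    intro x
    rw [enorm_pow_eq_ofReal, enorm_pow_eq_ofReal, hgv, mul_pow, hcn,
      ENNReal.ofReal_mul (by positivity)]
  have hae := hvt.weakGrad_ae_eq hΩ
  have hnorm : gradNorm Ω v = 1 := by
    rw [gradNorm, eLpNorm_congr_ae hae,
      eLpNorm_eq_lintegral_rpow_enorm_toReal (by exact_mod_cast hn0) (by simp),
      ENNReal.toReal_natCast]
    have h1 : ∫⁻ x in Ω, ‖gradient v x‖ₑ ^ (n : ℝ) = 1 := by
      simp only [ENNReal.rpow_natCast, hgv']
      rw [lintegral_const_mul' _ _ ENNReal.ofReal_ne_top,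
        setLIntegral_eq_of_support_subset, ← hA, hAa,
        ← ENNReal.ofReal_mul (by positivity), inv_mul_cancel₀ ha0.ne', ENNReal.ofReal_one]
      intro x hx
      by_contra hxΩ
      apply hx
      simp only
      rw [gradient_eq_zero_of_notMem_tsupport fun h => hxΩ (hφt.2.2 h), enorm_zero, zero_pow hn0]
    rw [h1, ENNReal.one_rpow]
  refine ⟨v, ⟨hvt.memW1n0 hΩ, hnorm.le⟩, hnorm, ?_, ?_⟩
  · intro ε hε
    have hm : MeasurableSet (Ω \ Metric.ball (0 : Eucl n) ε) :=
      hΩ.measurableSet.diff Metric.isOpen_ball.measurableSet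
    have hae' : ∀ᵐ x ∂volume.restrict (Ω \ Metric.ball (0 : Eucl n) ε),
        weakGrad Ω v x = gradient v x := ae_mono (Measure.restrict_mono sdiff_subset le_rfl) hae
    calc ∫⁻ x in Ω \ Metric.ball 0 ε, ‖weakGrad Ω v x‖ₑ ^ n
        = ∫⁻ x in Ω \ Metric.ball 0 ε, ‖gradient v x‖ₑ ^ n := by
          refine lintegral_congr_ae ?_
          filter_upwards [hae'] with x hx
          rw [hx]
      _ ≤ ∫⁻ x in Ω \ Metric.ball 0 ε,
            ENNReal.ofReal ((sphereArea n * (L - 2))⁻¹ * ε⁻¹ ^ n) := by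
          refine setLIntegral_mono' hm fun x hx => ?_
          have hεx : ε ≤ ‖x‖ := by
            have := hx.2
            rwa [mem_ball_zero_iff, not_lt] at this
          rw [hgv', enorm_pow_eq_ofReal, ← ENNReal.ofReal_mul (by positivity)]
          refine ENNReal.ofReal_le_ofReal ?_
          have h1 := (norm_gradient_moserFun_le (L := L) hR x).trans (inv_anti₀ hε hεx)
          gcongr
      _ ≤ _ := by
          rw [setLIntegral_const]
          gcongr
          exact sdiff_subset
  · set ρ := R * Real.exp (-L) with hρ
    have hρ0 : 0 < ρ := by positivity
    have hρR : ρ ≤ R := mul_le_of_le_one_right hR.le (Real.exp_le_one_iff.2 (by linarith))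
    have := nontrivial_eucl hn
    set V := volume.real (Metric.ball (0 : Eucl n) 1) with hV
    -- The origin is removed since for β > 0 the quotient takes the default value 0 there.
    have hm : MeasurableSet (Metric.ball (0 : Eucl n) ρ \ {0}) :=
      Metric.isOpen_ball.measurableSet.diff (measurableSet_singleton _)
    have hs : 0 < (n : ℝ) - β := by linarith
    have hexp1 : 0 ≤ Real.exp ((n - β) * (L - 4)) - 1 := by
      rw [sub_nonneg]
      exact Real.one_le_exp (mul_nonneg hs.le (by linarith))
    have hvol : volume (Metric.ball (0 : Eucl n) ρ \ {0}) = ENNReal.ofReal (ρ ^ n * V) := by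
      rw [measure_sdiff_null (measure_singleton _), Measure.addHaar_ball _ _ hρ0.le,
        finrank_euclideanSpace_fin, ENNReal.ofReal_mul (by positivity), hV,
        ofReal_measureReal measure_ball_lt_top.ne]
    calc ENNReal.ofReal (V * R ^ ((n : ℝ) - β) *
        (Real.exp (-4 * (n - β)) - Real.exp (-L * (n - β))))
        = ENNReal.ofReal ((Real.exp ((n - β) * (L - 4)) - 1) / ρ ^ β) *
            volume (Metric.ball (0 : Eucl n) ρ \ {0}) := by
          rw [hvol, ← ENNReal.ofReal_mul (by positivity)]
          congr 1
          have e1 : ρ ^ n / ρ ^ β = R ^ ((n : ℝ) - β) * Real.exp (-L * (n - β)) := by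
            rw [← Real.rpow_natCast, ← Real.rpow_sub hρ0, hρ, Real.mul_rpow hR.le (Real.exp_pos _).le,
              ← Real.exp_mul]
          have e2 : Real.exp (-4 * (n - β)) =
              Real.exp (-L * (n - β)) * Real.exp ((n - β) * (L - 4)) := by
            rw [← Real.exp_add]
            congr 1
            ring
          calc _ = V * (R ^ ((n : ℝ) - β) * Real.exp (-L * (n - β))) *
                (Real.exp ((n - β) * (L - 4)) - 1) := by rw [e2]; ring
            _ = _ := by rw [← e1]; ring
      _ = ∫⁻ x in Metric.ball (0 : Eucl n) ρ \ {0},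
            ENNReal.ofReal ((Real.exp ((n - β) * (L - 4)) - 1) / ρ ^ β) := by
          rw [setLIntegral_const]
      _ ≤ ∫⁻ x in Metric.ball (0 : Eucl n) ρ \ {0}, ENNReal.ofReal
            ((Real.exp (α * |v x| ^ ((n : ℝ) / ((n : ℝ) - 1))) - 1) / ‖x‖ ^ β) := by
          refine setLIntegral_mono' hm fun x hx => ENNReal.ofReal_le_ofReal ?_
          have hxρ : ‖x‖ < ρ := mem_ball_zero_iff.1 hx.1
          have hx0 : 0 < ‖x‖ := norm_pos_iff.2 hx.2
          have hvx : v x = c * moserProfile L L := by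
            rw [hv, hφ]
            simp only
            rw [moserFun_eq_const hR hxρ.le]
          have h1 := le_plateau_exponent hn hβn hαβ (by linarith) ha0 hale
            (sub_two_le_moserProfile (by linarith : 2 ≤ L))
          rw [hvx]
          gcongr
          exact hexp1.trans (sub_le_sub_right (Real.exp_le_exp.2 h1) 1)
      _ ≤ F α β Ω v := lintegral_mono_set (sdiff_subset.trans
          ((Metric.ball_subset_closedBall.trans (Metric.closedBall_subset_closedBall hρR)).trans hRΩ))

theorem Fdelta_pos (hn : 2 ≤ n) {Ω : Set (Eucl n)} (hΩ : IsOpen Ω) (hΩb : Bornology.IsBounded Ω)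
    (h0 : (0 : Eucl n) ∈ Ω) {α β : ℝ} (hβ : 0 ≤ β) (hβn : β < n)
    (hαβ : α / alphaCrit n + β / n = 1) : 0 < Fdelta α β Ω 0 := by
  have := nontrivial_eucl hn
  have hω := sphereArea_pos hn
  have hs : 0 < (n : ℝ) - β := by linarith
  obtain ⟨R, hR, hRΩ⟩ := Metric.nhds_basis_closedBall.mem_iff.1 (hΩ.mem_nhds h0)
  have hex : ∀ j : ℕ, _ := fun j => exists_moser_competitor hn hΩ hR hRΩ hβ hβn hαβ
    (L := (j : ℝ) + 4) (by linarith [(Nat.cast_nonneg j : (0 : ℝ) ≤ j)])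
  choose v hvb hvn hvc hvF using hex
  have hL : Tendsto (fun j : ℕ => (j : ℝ) + 4) atTop atTop :=
    tendsto_atTop_add_const_right _ _ tendsto_natCast_atTop_atTop
  have hconc : ConcentratesAt Ω v 0 := by
    refine ⟨by simp only [hvn]; exact tendsto_const_nhds, fun ε hε => ?_⟩
    refine tendsto_of_tendsto_of_tendsto_of_le_of_le tendsto_const_nhds ?_ (fun _ => zero_le)
      fun j => hvc j ε hε
    have h1 : Tendsto (fun j : ℕ => (sphereArea n * ((j : ℝ) + 4 - 2))⁻¹ * ε⁻¹ ^ n) atTop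
        (𝓝 (0 * ε⁻¹ ^ n)) := by
      refine Tendsto.mul_const _ (tendsto_inv_atTop_zero.comp ?_)
      exact (tendsto_atTop_add_const_right _ (-2) hL).const_mul_atTop hω
    have h2 := ENNReal.Tendsto.mul_const (b := volume Ω) (ENNReal.tendsto_ofReal h1)
      (Or.inr hΩb.measure_lt_top.ne)
    rwa [zero_mul, ENNReal.ofReal_zero, zero_mul] at h2
  have hV : 0 < volume.real (Metric.ball (0 : Eucl n) 1) :=
    ENNReal.toReal_pos (Metric.measure_ball_pos volume _ one_pos).ne' measure_ball_lt_top.ne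
  set V := volume.real (Metric.ball (0 : Eucl n) 1)
  have hlim : Tendsto (fun j : ℕ => V * R ^ ((n : ℝ) - β) *
      (Real.exp (-4 * (n - β)) - Real.exp (-((j : ℝ) + 4) * (n - β)))) atTop
      (𝓝 (V * R ^ ((n : ℝ) - β) * (Real.exp (-4 * (n - β)) - 0))) := by
    refine Tendsto.const_mul _ (Tendsto.const_sub _ (Real.tendsto_exp_atBot.comp ?_))
    exact (tendsto_neg_atTop_atBot.comp hL).atBot_mul_const hs
  rw [sub_zero] at hlim
  set c := V * R ^ ((n : ℝ) - β) * Real.exp (-4 * (n - β)) with hc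
  have hc0 : 0 < c := by positivity
  have hev : ∀ᶠ j in atTop, ENNReal.ofReal (c / 2) ≤ F α β Ω (v j) := by
    filter_upwards [hlim.eventually_const_lt (half_lt_self hc0)] with j hj
    exact (ENNReal.ofReal_le_ofReal hj.le).trans (hvF j)
  refine lt_of_lt_of_le (ENNReal.ofReal_pos.2 (half_pos hc0)) ?_
  exact (le_limsup_of_frequently_le' hev.frequently).trans (le_sSup ⟨v, hvb, hconc, rfl⟩)

end MoserSequence

end MoserTrudinger

/-! ### The theorem -/

theorem mainTheorem9 (n : ℕ) (hn : 2 ≤ n) (Ω : Set (EuclideanSpace ℝ (Fin n)))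
    (hΩ_open : IsOpen Ω) (hΩ_bdd : Bornology.IsBounded Ω)
    (hΩ_smooth : MoserTrudinger.HasSmoothBoundary Ω)
    (hΩ_zero : (0 : EuclideanSpace ℝ (Fin n)) ∈ Ω)
    (α β : ℝ) (hα : 0 < α) (hβ : 0 ≤ β) (hβn : β < n)
    (hαβ : α / MoserTrudinger.alphaCrit n + β / n = 1)
    (u : ℕ → EuclideanSpace ℝ (Fin n) → ℝ)
    (hu : ∀ i, u i ∈ MoserTrudinger.unitBall Ω)
    (hu_smooth : ∀ i, ContDiffOn ℝ ∞ (u i) Ω)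
    (hu_nonneg : ∀ i, ∀ x ∈ Ω, 0 ≤ u i x)
    (hu_conc : MoserTrudinger.ConcentratesAt Ω u 0)
    (hu_max : Tendsto (fun i => MoserTrudinger.F α β Ω (u i)) atTop
      (𝓝 (MoserTrudinger.Fdelta α β Ω 0)))
    (r : ℝ) (hr : 0 < r) :
    ∃ j : ℕ, ∃ k ∈ Set.Icc (1 : ℝ) 2,
      ({x ∈ Ω | k ≤ u j x} ∩ Metric.ball 0 r).Nonempty ∧
      ∀ x ∈ {x ∈ Ω | k ≤ u j x},
        ((connectedComponentIn {x ∈ Ω | k ≤ u j x} x ∩ Metric.ball 0 r).Nonempty →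
          connectedComponentIn {x ∈ Ω | k ≤ u j x} x ⊆ Metric.ball 0 (2 * r)) ∧
        MoserTrudinger.HasSmoothBoundary (connectedComponentIn {x ∈ Ω | k ≤ u j x} x) := by
  open MoserTrudinger in
  obtain ⟨M, hM, hΩM⟩ := hΩ_bdd.subset_ball_lt 0 0
  obtain ⟨κ, hκ, hcross⟩ := exists_energy_bound_subset_ball hn hM hr
  have hmem : ∀ j, MemW1n0 Ω (u j) := fun j => (hu j).1
  have hcont : ∀ j, ContinuousOn (u j) Ω := fun j => (hu_smooth j).continuousOn
  -- Exceeding 2 makes the superlevel set meet B_r(0) for every level in [1, 2], so `k` can still be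
  -- chosen freely. Frequently suffices, as the energy condition holds eventually.
  have hlarge : ∃ᶠ j in atTop, ∃ x ∈ Ω ∩ Metric.ball 0 r, 2 < u j x := by
    intro hcon
    have hB : ∀ᶠ j in atTop, ∀ x ∈ Ω ∩ Metric.ball 0 r, |u j x| ≤ 2 := by
      filter_upwards [hcon] with j hj x hx
      rw [abs_of_nonneg (hu_nonneg j x hx.1)]
      by_contra! h
      exact hj ⟨x, hx, h⟩
    have h0 := tendsto_F_zero_of_bounded hn hΩ_open hΩ_bdd hα hβ hβn hmem hcont hu_conc hr hB
    exact (Fdelta_pos hn hΩ_open hΩ_bdd hΩ_zero hβ hβn hαβ).ne' (tendsto_nhds_unique hu_max h0)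
  obtain ⟨j, ⟨x₀, hx₀, hx₀u⟩, hj⟩ := (hlarge.and_eventually
    ((hu_conc.tendsto_energy (by omega) hΩ_open (half_pos hr)).eventually_lt_const hκ)).exists
  -- The critical values are null by Sard, and [1, 2] has measure 1.
  obtain ⟨k, hk, hkreg⟩ : ∃ k ∈ Icc (1 : ℝ) 2, k ∉ u j '' {x ∈ Ω | fderiv ℝ (u j) x = 0} := by
    by_contra! h
    have h1 := measure_mono_null (μ := volume) (s := Icc (1 : ℝ) 2) h
      (volume_image_critical_eq_zero hΩ_open (hu_smooth j))
    rw [Real.volume_Icc] at h1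
    norm_num at h1
  have hreg : ∀ x ∈ Ω, u j x = k → fderiv ℝ (u j) x ≠ 0 :=
    fun x hx hxk hd => hkreg ⟨x, ⟨hx, hd⟩, hxk⟩
  refine ⟨j, k, hk, ⟨x₀, ⟨hx₀.1, hk.2.trans hx₀u.le⟩, hx₀.2⟩, fun x hx => ⟨?_, ?_⟩⟩
  · refine hcross _ _ ((hmem j).isSobolevLimit hΩ_open) (fun y hy => ?_) hj _
      isPreconnected_connectedComponentIn fun y hy => ?_
    · refine indicator_of_notMem (fun h => ?_) _
      have := mem_ball_zero_iff.1 (hΩM h)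
      linarith
    · have hyS := connectedComponentIn_subset _ _ hy
      refine ⟨continuousAt_indicator_of_mem hΩ_open (hcont j) hyS.1, ?_⟩
      rw [indicator_of_mem hyS.1]
      exact hk.1.trans hyS.2
  · refine hasSmoothBoundary_connectedComponentIn hΩ_open (hu_smooth j) hreg ?_
    exact closure_subset_of_isPreconnected hn hΩ_open hΩ_smooth (hmem j) (hcont j)
      isPreconnected_connectedComponentIn (fun y hy => (connectedComponentIn_subset _ _ hy).1)
      fun y hy => hk.1.trans (connectedComponentIn_subset _ _ hy).2
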